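/- Let $\mathcal H$ be a class of finite simple graphs. In the problem Vertex Disjoint List $\mathcal H$-Packing, an instance consists of a finite simple graph $G$, a non-negative integer $k$ (written in binary), and a list $\mathcal L$ of distinct subgraphs of $G$, each isomorphic to some graph in $\mathcal H$; the question is whether there is $\mathcal S\subseteq\mathcal L$ with $|\mathcal S|\ge k$ whose members are pairwise vertex-disjoint. Let $n=|V(G)|$ and let $\mathrm{tw}$ be the treewidth of $G$. Here graphs and subgraphs are given by their vertex sets and adjacency matrices, and time is the number of elementary steps of a WHILE program on binary trees (a list-processing machine with unit-cost cons, head, tail, and emptiness test, which is polynomially equivalent to Turing machines). Theorem. Suppose that every graph in $\mathcal H$ is connected (in particular, has at least one vertex). 1. Vertex Disjoint List $\mathcal H$-Packing is solvable in $(n+|\mathcal L|)^{O(\mathrm{tw})}$ time, where the constant in the exponent does not depend on $\mathcal H$. 2. If moreover $\mathcal H$ is finite, then Vertex Disjoint List $\mathcal H$-Packing is solvable in $n^{O(\mathrm{tw})}$ time, where the constant in the exponent may depend on $\mathcal H$ only. Here $N^{O(\mathrm{tw})}$ stands for $\max(N,2)^{c\cdot\max(\mathrm{tw},1)}$ with a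 constant $c$, so that it is $N^{c\cdot\mathrm{tw}}$ as soon as $N\ge 2$ and $\mathrm{tw}\ge 1$. -/

import Mathlib

namespace ListPacking

/-! ### The model of computation

The WHILE language over binary trees, which is the standard list-processing model: a program
works on finitely many variables whose values are pointers to immutable cons cells, and every
elementary operation (reading a variable, `nil`, `cons`, `hd`, `tl`, an assignment, a test for
`nil`) takes one step.  Running times in this model, on multitape Turing machines and on random
access machines (with logarithmic cost) agree up to a fixed polynomial. -/

/-- Values: binary trees built from `nil` by pairing. -/
inductive Dat : Type
  | nil : Dat
  | cons : Dat → Dat → Dat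

/-- First component of a pair; `nil` has first component `nil`. -/
def Dat.hd : Dat → Dat
  | .nil => .nil
  | .cons a _ => a

/-- Second component of a pair; `nil` has second component `nil`. -/
def Dat.tl : Dat → Dat
  | .nil => .nil
  | .cons _ b => b

/-- A store assigns a value to each of the variables `0, 1, 2, …`. -/
abbrev Store : Type := ℕ → Dat

/-- Expressions. -/
inductive Exp : Type
  | var : ℕ → Exp
  | nil : Exp
  | cons : Exp → Exp → Exp
  | hd : Exp → Exp
  | tl : Exp → Exp

/-- The value of an expression in a store. -/
def Exp.eval (σ : Store) : Exp → Dat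
  | .var i => σ i
  | .nil => .nil
  | .cons a b => .cons (a.eval σ) (b.eval σ)
  | .hd a => (a.eval σ).hd
  | .tl a => (a.eval σ).tl

/-- The number of steps that the evaluation of an expression takes: one for each operation. -/
def Exp.cost : Exp → ℕ
  | .var _ => 1
  | .nil => 1
  | .cons a b => a.cost + b.cost + 1
  | .hd a => a.cost + 1
  | .tl a => a.cost + 1

/-- Programs. A value counts as true in a test if it is not `nil`. -/
inductive Prog : Type
  | assign : ℕ → Exp → Prog
  | seq : Prog → Prog → Prog
  | ite : Exp → Prog → Prog → Prog
  | loop : Exp → Prog → Prog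

/-- `Exec p σ t σ'`: started in the store `σ`, the program `p` halts after exactly `t` steps, in
the store `σ'`. -/
inductive Exec : Prog → Store → ℕ → Store → Prop
  | assign (i : ℕ) (e : Exp) (σ : Store) :
      Exec (.assign i e) σ (e.cost + 1) (Function.update σ i (e.eval σ))
  | seq {p q : Prog} {σ σ' σ'' : Store} {t t' : ℕ} :
      Exec p σ t σ' → Exec q σ' t' σ'' → Exec (.seq p q) σ (t + t') σ''
  | iteTrue {e : Exp} {p q : Prog} {σ σ' : Store} {t : ℕ} :
      e.eval σ ≠ .nil → Exec p σ t σ' → Exec (.ite e p q) σ (e.cost + 1 + t) σ'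
  | iteFalse {e : Exp} {p q : Prog} {σ σ' : Store} {t : ℕ} :
      e.eval σ = .nil → Exec q σ t σ' → Exec (.ite e p q) σ (e.cost + 1 + t) σ'
  | loopTrue {e : Exp} {p : Prog} {σ σ' σ'' : Store} {t t' : ℕ} :
      e.eval σ ≠ .nil → Exec p σ t σ' → Exec (.loop e p) σ' t' σ'' →
        Exec (.loop e p) σ (e.cost + 1 + t + t') σ''
  | loopFalse {e : Exp} {p : Prog} {σ : Store} :
      e.eval σ = .nil → Exec (.loop e p) σ (e.cost + 1) σ

/-- The initial store: the input is the value of variable `0`, all other variables are `nil`. -/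
def initStore (x : Dat) : Store := fun i => if i = 0 then x else .nil

/-- Truth values as trees. -/
def encBool : Bool → Dat
  | true => .cons .nil .nil
  | false => .nil

/-- Lists as trees. -/
def encList : List Dat → Dat
  | [] => .nil
  | a :: l => .cons a (encList l)

/-- The decision problem with instances `α`, encoded by `enc`, and with yes-instances `yes` is
solvable in time `bound`: some program halts on each instance `a` after at most `bound a` steps
and leaves the correct answer in variable `0`. -/
def SolvableInTime {α : Type} (enc : α → Dat) (yes : α → Prop) (bound : α → ℕ) : Prop :=
  ∃ p : Prog, ∀ a : α, ∃ (t : ℕ) (σ : Store),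
    Exec p (initStore (enc a)) t σ ∧ t ≤ bound a ∧
      (yes a → σ 0 = encBool true) ∧ (¬ yes a → σ 0 = encBool false)

/-! ### Treewidth -/

/-- A tree decomposition of `G`, with nodes `0, …, m - 1`. -/
structure TreeDecomposition {V : Type} (G : SimpleGraph V) where
  m : ℕ
  tree : SimpleGraph (Fin m)
  isTree : tree.IsTree
  bag : Fin m → Finset V
  vertex_mem : ∀ v : V, ∃ i, v ∈ bag i
  edge_mem : ∀ u v : V, G.Adj u v → ∃ i, u ∈ bag i ∧ v ∈ bag i
  subtree : ∀ v : V, (tree.induce {i | v ∈ bag i}).Connected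

/-- The width: the maximum size of a bag, minus one. -/
def TreeDecomposition.width {V : Type} {G : SimpleGraph V} (D : TreeDecomposition G) : ℕ :=
  (Finset.univ.sup fun i => (D.bag i).card) - 1

/-- The treewidth: the minimum width of a tree decomposition (`0` for the graph without
vertices). -/
noncomputable def treewidth {V : Type} (G : SimpleGraph V) : ℕ :=
  sInf {w | ∃ D : TreeDecomposition G, D.width = w}

/-! ### Vertex Disjoint List `𝓗`-Packing -/

/-- Finite graphs, up to isomorphism: graphs with vertex set `{0, …, m - 1}`. -/
abbrev FinGraph : Type := Σ m : ℕ, SimpleGraph (Fin m)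

/-- An instance: a graph `G` with `n` vertices, a number `k`, and a list (without repetitions)
of subgraphs of `G`, each of which is isomorphic to some graph in `𝓗`. -/
structure Instance (𝓗 : Set FinGraph) where
  n : ℕ
  G : SimpleGraph (Fin n)
  k : ℕ
  L : List G.Subgraph
  nodup : L.Nodup
  iso_mem : ∀ F ∈ L, ∃ H ∈ 𝓗, Nonempty (F.coe ≃g H.2)

/-- The question: are there at least `k` subgraphs in the list that are pairwise
vertex-disjoint? -/
def Instance.IsYes {𝓗 : Set FinGraph} (I : Instance 𝓗) : Prop :=
  ∃ S : Finset I.G.Subgraph, (∀ F ∈ S, F ∈ I.L) ∧ I.k ≤ S.card ∧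
    (S : Set I.G.Subgraph).Pairwise fun F F' => Disjoint F.verts F'.verts

open Classical in
/-- The characteristic vector of a set of vertices, as a list of `n` bits. -/
noncomputable def encSet {n : ℕ} (s : Set (Fin n)) : Dat :=
  encList (List.ofFn fun i => encBool (decide (i ∈ s)))

/-- The matrix of a relation on the vertices, as a list of `n` rows. -/
noncomputable def encRel {n : ℕ} (r : Fin n → Fin n → Prop) : Dat :=
  encList (List.ofFn fun i => encSet {j | r i j})

/-- A subgraph: its set of vertices and its adjacency matrix. -/
noncomputable def encSubgraph {n : ℕ} {G : SimpleGraph (Fin n)} (F : G.Subgraph) : Dat :=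
  .cons (encSet F.verts) (encRel F.Adj)

/-- An instance: the adjacency matrix of `G`, the list of subgraphs, and `k` in binary. -/
noncomputable def Instance.encode {𝓗 : Set FinGraph} (I : Instance 𝓗) : Dat :=
  .cons (encRel I.G.Adj)
    (.cons (encList (I.L.map encSubgraph)) (encList (I.k.bits.map encBool)))

end ListPacking

/-!
The packing is found by dynamic programming over separators, which needs no tree decomposition as
input and does not compute one.

Let `R` be a vertex set and `X` a set of at most `w + 1` vertices. In a packing of members inside
`R`, at most `w + 1` members meet `X`. If these form the family `Q`, each of the others is connected
and misses `X ∪ ⋃ Q`, so it lies in one component of `R \ (X ∪ ⋃ Q)`. Hence the maximum size of a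
packing in `R` is the maximum, over the families `Q` of disjoint members that are contained in `R`
and meet `X`, of `|Q|` plus the sum of the maxima for these components (`isOpt_of_separator`,
`IsOpt.add`). The algorithm (`solve`) keeps a table of correct values. A set `R` is entered as
soon as *some* `X` is such that for *all* `Q` the components have values already. So whenever
the table covers the components of the graph, the result is correct, whatever `w` is
(`isOpt_solve`). Only sets of the form "component of `G - X - ⋃ Q`", with at most `w + 1` vertices
in `X` and at most `w + 1` members in `Q`, are considered (`keys`), so for fixed `w` the time is
polynomial in the input size and the number of pairs `(X, Q)`, that is, `(n + |L|) ^ O(w)`.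

The table covers all components if `w` is the treewidth (`solve_of_isSeparatorSystem`). The only
property of a tree decomposition that is used is that of the bags in `IsSeparatorSystem`: if the
neighbours of a connected set `C` lie in one bag, they also lie in a bag that meets `C`, namely
that of the closest node whose bag meets `C`, since this node is a gate through which all paths to
such nodes lead (`TreeDecomposition.isSeparatorSystem`). Removing the new bag splits `C` into
smaller sets of the same kind (`exists_smaller_state`). The program tries `w = 0, 1, 2, …` until the
computation succeeds, which is the case at the treewidth at the latest
(`Instance.searchLoop_spec`). It reads only `|L| + 1` digits of `k`, since the time must not depend
on the length of `k`.

Programs are not written down in full. `ComputesIn` says that a function on encoded data is computed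
within a time bound, and is closed under composition, pairing, case distinction and loops over
lists. From this, the functions computable in polynomial time (`PolyTime`) get closure properties
that `fun_prop` can apply, so that the polynomial part of the algorithm is an ordinary function on
lists. Polynomial time refers to the size of the argument, and the exponential dependence on the
treewidth comes only from the lists of separators and families that `search` passes on.

If `𝓗` is finite, then `|L|` is bounded by a polynomial in `n` (`exists_length_le`), and the second
part follows from the first.
-/

namespace ListPacking

/-! ### Timed computation of functions on encoded data -/

/-- Types whose elements are encoded as trees. -/
class Code (α : Type) where
  /-- The encoding. -/
  enc : α → Dat

open Code (enc)

instance : Code Unit := ⟨fun _ => .nil⟩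
instance : Code Bool := ⟨encBool⟩
instance {α β : Type} [Code α] [Code β] : Code (α × β) := ⟨fun p => .cons (enc p.1) (enc p.2)⟩
instance {α : Type} [Code α] : Code (List α) := ⟨fun l => encList (l.map enc)⟩
/-- Natural numbers are encoded in unary. -/
instance : Code ℕ := ⟨fun n => encList (List.replicate n .nil)⟩

section enc
variable {α β γ : Type} [Code α] [Code β] [Code γ]

@[simp] lemma enc_prod (p : α × β) : enc p = .cons (enc p.1) (enc p.2) := rfl
@[simp] lemma enc_list_nil : enc ([] : List α) = .nil := rfl
@[simp] lemma enc_list_cons (a : α) (l : List α) : enc (a :: l) = .cons (enc a) (enc l) := rfl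
@[simp] lemma enc_nat_zero : enc (0 : ℕ) = .nil := rfl
@[simp] lemma enc_nat_succ (n : ℕ) : enc (n + 1) = .cons .nil (enc n) := rfl
@[simp] lemma enc_true : enc true = .cons .nil .nil := rfl
@[simp] lemma enc_false : enc false = .nil := rfl
@[simp] lemma enc_unit (u : Unit) : enc u = .nil := rfl

/-- `ComputesIn f T`: a program computes `f`, on each argument `a` in at most `T a` steps. The
program can be placed at any variable `d`: it takes its argument from `d`, leaves the value in
`d`, and does not change the variables below `d`, in which the surrounding program keeps its own
data. -/
def ComputesIn (f : α → β) (T : α → ℕ) : Prop :=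
  ∃ p : ℕ → Prog, ∀ (d : ℕ) (σ : Store) (a : α), σ d = enc a →
    ∃ (t : ℕ) (σ' : Store), Exec (p d) σ t σ' ∧ t ≤ T a ∧ σ' d = enc (f a) ∧ ∀ i < d, σ' i = σ i

namespace ComputesIn

lemma mono {f : α → β} {T T' : α → ℕ} (h : ComputesIn f T) (hT : ∀ a, T a ≤ T' a) :
    ComputesIn f T' := by
  obtain ⟨p, hp⟩ := h
  refine ⟨p, fun d σ a ha => ?_⟩
  obtain ⟨t, σ', h1, h2, h3⟩ := hp d σ a ha
  exact ⟨t, σ', h1, h2.trans (hT a), h3⟩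

/-- A function given by a single expression is computed in constant time. -/
lemma of_exp {f : α → β} (e : ℕ → Exp) (c : ℕ) (hc : ∀ d, (e d).cost ≤ c)
    (he : ∀ d σ a, σ d = enc a → (e d).eval σ = enc (f a)) : ComputesIn f fun _ => c + 1 := by
  refine ⟨fun d => .assign d (e d), fun d σ a ha => ⟨_, _, .assign d (e d) σ, ?_, ?_, ?_⟩⟩
  · exact Nat.succ_le_succ (hc d)
  · simpa using he d σ a ha
  · intro i hi
    simp [hi.ne]

lemma comp {g : β → γ} {f : α → β} {S : β → ℕ} {T : α → ℕ} (hg : ComputesIn g S)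
    (hf : ComputesIn f T) : ComputesIn (fun a => g (f a)) fun a => T a + S (f a) := by
  obtain ⟨p, hp⟩ := hf
  obtain ⟨q, hq⟩ := hg
  refine ⟨fun d => .seq (p d) (q d), fun d σ a ha => ?_⟩
  obtain ⟨t, σ₁, h1, h2, h3, h4⟩ := hp d σ a ha
  obtain ⟨u, σ₂, k1, k2, k3, k4⟩ := hq d σ₁ (f a) h3
  exact ⟨_, _, .seq h1 k1, Nat.add_le_add h2 k2, k3, fun i hi => (k4 i hi).trans (h4 i hi)⟩

lemma pair {f : α → β} {g : α → γ} {S T : α → ℕ} (hf : ComputesIn f S) (hg : ComputesIn g T) :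
    ComputesIn (fun a => (f a, g a)) fun a => S a + T a + 8 := by
  obtain ⟨p, hp⟩ := hf
  obtain ⟨q, hq⟩ := hg
  refine ⟨fun d => .seq (.assign (d + 1) (.var d)) (.seq (p (d + 1))
    (.seq (.assign (d + 2) (.var d)) (.seq (q (d + 2))
      (.assign d (.cons (.var (d + 1)) (.var (d + 2))))))), fun d σ a ha => ?_⟩
  obtain ⟨t, σ₁, h1, h2, h3, h4⟩ :=
    hp (d + 1) (Function.update σ (d + 1) ((Exp.var d).eval σ)) a (by simpa [Exp.eval] using ha)
  have hd : σ₁ d = enc a := by rw [h4 d (by omega)]; simpa using ha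
  obtain ⟨u, σ₂, k1, k2, k3, k4⟩ :=
    hq (d + 2) (Function.update σ₁ (d + 2) ((Exp.var d).eval σ₁)) a (by simpa [Exp.eval] using hd)
  refine ⟨_, _, .seq (.assign _ _ _) (.seq h1 (.seq (.assign _ _ _) (.seq k1 (.assign _ _ _)))),
    ?_, ?_, ?_⟩
  · simp only [Exp.cost]
    omega
  · have : σ₂ (d + 1) = enc (f a) := by rw [k4 (d + 1) (by omega)]; simpa using h3
    simp [Exp.eval, this, k3]
  · intro i hi
    rw [Function.update_of_ne hi.ne, k4 i (by omega), Function.update_of_ne (by omega),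
      h4 i (by omega), Function.update_of_ne (by omega)]

lemma ite {c : α → Bool} {f g : α → β} {R S T : α → ℕ} (hc : ComputesIn c R)
    (hf : ComputesIn f S) (hg : ComputesIn g T) :
    ComputesIn (fun a => if c a then f a else g a)
      fun a => R a + (if c a then S a else T a) + 4 := by
  obtain ⟨r, hr⟩ := hc
  obtain ⟨p, hp⟩ := hf
  obtain ⟨q, hq⟩ := hg
  refine ⟨fun d => .seq (.assign (d + 1) (.var d)) (.seq (r (d + 1))
    (.ite (.var (d + 1)) (p d) (q d))), fun d σ a ha => ?_⟩
  obtain ⟨t, σ₁, h1, h2, h3, h4⟩ :=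
    hr (d + 1) (Function.update σ (d + 1) ((Exp.var d).eval σ)) a (by simpa [Exp.eval] using ha)
  have hlt : ∀ i ≤ d, σ₁ i = σ i := fun i hi => by
    rw [h4 i (by omega), Function.update_of_ne (by omega)]
  have hd : σ₁ d = enc a := by rw [hlt d le_rfl, ha]
  cases hca : c a with
  | true =>
    obtain ⟨u, σ₂, k1, k2, k3, k4⟩ := hp d σ₁ a hd
    refine ⟨_, σ₂, .seq (.assign _ _ _) (.seq h1 (.iteTrue ?_ k1)), ?_, by simpa [hca] using k3,
      fun i hi => (k4 i hi).trans (hlt i hi.le)⟩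
    · simp [Exp.eval, h3, hca]
    · simp only [Exp.cost, hca, if_true]
      omega
  | false =>
    obtain ⟨u, σ₂, k1, k2, k3, k4⟩ := hq d σ₁ a hd
    refine ⟨_, σ₂, .seq (.assign _ _ _) (.seq h1 (.iteFalse ?_ k1)), ?_, by simpa [hca] using k3,
      fun i hi => (k4 i hi).trans (hlt i hi.le)⟩
    · simp [Exp.eval, h3, hca]
    · simp only [Exp.cost, hca, Bool.false_eq_true, if_false]
      omega

/-- A loop over a list: the time is the length of the list times a bound `B` on the time that the
body takes in the situations that occur. -/
lemma foldl {s : α → β → γ → β} {b : α → β} {l : α → List γ} {S : α × β × γ → ℕ} {Tb Tl : α → ℕ}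
    (hs : ComputesIn (fun q : α × β × γ => s q.1 q.2.1 q.2.2) S) (hb : ComputesIn b Tb)
    (hl : ComputesIn l Tl) {B : α → ℕ}
    (hB : ∀ a l₁ x l₂, l a = l₁ ++ x :: l₂ → S (a, l₁.foldl (s a) (b a), x) ≤ B a) :
    ComputesIn (fun a => (l a).foldl (s a) (b a))
      fun a => Tb a + Tl a + (l a).length * (B a + 14) + 10 := by
  obtain ⟨p, hp⟩ := hs
  obtain ⟨pb, hpb⟩ := hb
  obtain ⟨pl, hpl⟩ := hl
  let body : ℕ → Prog := fun d =>
    .seq (.assign (d + 4) (.cons (.var (d + 1)) (.cons (.var (d + 2)) (.hd (.var (d + 3))))))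
      (.seq (p (d + 4)) (.seq (.assign (d + 2) (.var (d + 4)))
        (.assign (d + 3) (.tl (.var (d + 3))))))
  have key : ∀ (d : ℕ) (a : α) (m : ℕ) (l : List γ) (b : β) (σ : Store),
      σ (d + 1) = enc a → σ (d + 2) = enc b → σ (d + 3) = enc l →
      (∀ l₁ x l₂, l = l₁ ++ x :: l₂ → S (a, l₁.foldl (s a) b, x) ≤ m) →
      ∃ t σ', Exec (.loop (.var (d + 3)) (body d)) σ t σ' ∧ t ≤ l.length * (m + 14) + 2 ∧
        σ' (d + 2) = enc (l.foldl (s a) b) ∧ ∀ i < d, σ' i = σ i := by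
    intro d a m l
    induction l with
    | nil =>
      intro b σ h1 h2 h3 _
      exact ⟨_, σ, .loopFalse (by simpa [Exp.eval] using h3), by simp [Exp.cost], by simpa using h2,
        fun _ _ => rfl⟩
    | cons x l ih =>
      intro b σ h1 h2 h3 hm
      obtain ⟨t, σ₁, k1, k2, k3, k4⟩ := hp (d + 4) (Function.update σ (d + 4)
        ((Exp.cons (.var (d + 1)) (.cons (.var (d + 2)) (.hd (.var (d + 3))))).eval σ)) (a, b, x)
        (by simp [Exp.eval, h1, h2, h3, Dat.hd])
      have hlt : ∀ i < d + 4, σ₁ i = σ i := fun i hi => by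
        rw [k4 i hi, Function.update_of_ne hi.ne]
      have e1 := hlt (d + 1) (by omega)
      have e3 := hlt (d + 3) (by omega)
      obtain ⟨u, σ₂, j1, j2, j3, j4⟩ := ih (s a b x)
        (Function.update (Function.update σ₁ (d + 2) ((Exp.var (d + 4)).eval σ₁)) (d + 3)
          ((Exp.tl (.var (d + 3))).eval
            (Function.update σ₁ (d + 2) ((Exp.var (d + 4)).eval σ₁))))
        (by simp [e1, h1]) (by simp [Exp.eval, k3])
        (by simp [Exp.eval, e3, h3, Dat.tl])
        (fun l₁ y l₂ hl => hm (x :: l₁) y l₂ (by simp [hl]))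
      refine ⟨_, σ₂, .loopTrue (by simp [Exp.eval, h3])
        (.seq (.assign _ _ _) (.seq k1 (.seq (.assign _ _ _) (.assign _ _ _)))) j1, ?_, ?_, ?_⟩
      · have := hm [] x l rfl
        simp only [List.foldl_nil] at this
        simp only [Exp.cost, List.length_cons, Nat.succ_mul]
        omega
      · simpa using j3
      · intro i hi
        rw [j4 i hi, Function.update_of_ne (by omega), Function.update_of_ne (by omega),
          hlt i (by omega)]
  refine ⟨fun d => .seq (.assign (d + 1) (.var d)) (.seq (.assign (d + 2) (.var d))
    (.seq (pb (d + 2)) (.seq (.assign (d + 3) (.var d)) (.seq (pl (d + 3))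
      (.seq (.loop (.var (d + 3)) (body d)) (.assign d (.var (d + 2)))))))), fun d σ a ha => ?_⟩
  let σ₁ : Store := Function.update σ (d + 1) ((Exp.var d).eval σ)
  obtain ⟨t, σ₂, h1, h2, h3, h4⟩ := hpb (d + 2) (Function.update σ₁ (d + 2) ((Exp.var d).eval σ₁)) a
    (by simpa [Exp.eval, σ₁] using ha)
  have hlt : ∀ i < d + 1, σ₂ i = σ i := fun i hi => by
    rw [h4 i (by omega), Function.update_of_ne (by omega)]
    exact Function.update_of_ne (by omega) _ _
  have h5 : σ₂ (d + 1) = enc a := by rw [h4 _ (by omega)]; simpa [σ₁, Exp.eval] using ha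
  have h6 : σ₂ d = enc a := by rw [hlt d (by omega), ha]
  obtain ⟨u, σ₃, k1, k2, k3, k4⟩ := hpl (d + 3) (Function.update σ₂ (d + 3) ((Exp.var d).eval σ₂)) a
    (by simpa [Exp.eval] using h6)
  obtain ⟨v, σ₄, j1, j2, j3, j4⟩ := key d a (B a) (l a) (b a) σ₃
    (by rw [k4 _ (by omega)]; simpa using h5) (by rw [k4 _ (by omega)]; simpa using h3) k3 (hB a)
  refine ⟨_, _, .seq (.assign _ _ _) (.seq (.assign _ _ _) (.seq h1 (.seq (.assign _ _ _)
    (.seq k1 (.seq j1 (.assign _ _ _)))))), ?_, ?_, ?_⟩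
  · simp only [Exp.cost]
    omega
  · simp [Exp.eval, j3]
  · intro i hi
    rw [Function.update_of_ne hi.ne, j4 i hi, k4 i (by omega), Function.update_of_ne (by omega),
      hlt i (by omega)]

/-- A value counts as true in a test if it is not `nil`, so lists can be tested like truth
values. -/
lemma isEmpty : ComputesIn (fun l : List α => l.isEmpty) fun _ => 6 := by
  refine ⟨fun d => .ite (.var d) (.assign d .nil) (.assign d (.cons .nil .nil)), fun d σ l h => ?_⟩
  cases l with
  | nil =>
    exact ⟨_, _, .iteFalse (by simpa [Exp.eval] using h) (.assign _ _ _), by simp [Exp.cost],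
      by simp [Exp.eval], fun i hi => by simp [hi.ne]⟩
  | cons x l =>
    exact ⟨_, _, .iteTrue (by simp [Exp.eval, h]) (.assign _ _ _), by simp [Exp.cost],
      by simp [Exp.eval], fun i hi => by simp [hi.ne]⟩

end ComputesIn
end enc

/-! ### Polynomial time -/

/-- `PolyBdd N f`: the function `f` is bounded by a fixed power of `N`. -/
def PolyBdd {ι : Type*} (N f : ι → ℕ) : Prop := ∃ c, ∀ i, f i ≤ N i ^ c

namespace PolyBdd
variable {ι κ : Type*} {N f g : ι → ℕ}

lemma mono (hg : PolyBdd N g) (h : ∀ i, f i ≤ g i) : PolyBdd N f := by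
  obtain ⟨c, hc⟩ := hg
  exact ⟨c, fun i => (h i).trans (hc i)⟩

lemma self : PolyBdd N N := ⟨1, fun i => by simp⟩

lemma const (hN : ∀ i, 2 ≤ N i) (k : ℕ) : PolyBdd N fun _ => k :=
  ⟨k, fun i => (Nat.lt_two_pow_self).le.trans (Nat.pow_le_pow_left (hN i) k)⟩

lemma mul (hf : PolyBdd N f) (hg : PolyBdd N g) : PolyBdd N fun i => f i * g i := by
  obtain ⟨c, hc⟩ := hf
  obtain ⟨d, hd⟩ := hg
  exact ⟨c + d, fun i => by rw [pow_add]; exact Nat.mul_le_mul (hc i) (hd i)⟩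

lemma add (hN : ∀ i, 2 ≤ N i) (hf : PolyBdd N f) (hg : PolyBdd N g) :
    PolyBdd N fun i => f i + g i := by
  obtain ⟨c, hc⟩ := hf
  obtain ⟨d, hd⟩ := hg
  refine ⟨max c d + 1, fun i => ?_⟩
  have h1 : 1 ≤ N i := (hN i).trans' one_le_two
  have hc' := (hc i).trans (Nat.pow_le_pow_right h1 (le_max_left c d))
  have hd' := (hd i).trans (Nat.pow_le_pow_right h1 (le_max_right c d))
  rw [pow_succ]
  nlinarith [hN i, Nat.zero_le (N i ^ max c d)]

lemma pow (hf : PolyBdd N f) (k : ℕ) : PolyBdd N fun i => f i ^ k := by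
  obtain ⟨c, hc⟩ := hf
  exact ⟨c * k, fun i => by rw [pow_mul]; exact Nat.pow_le_pow_left (hc i) k⟩

lemma trans (hg : PolyBdd g f) (hf : PolyBdd N g) : PolyBdd N f := by
  obtain ⟨k, hk⟩ := hg
  exact (hf.pow k).mono hk

lemma comp_right (hf : PolyBdd N f) (h : κ → ι) : PolyBdd (fun k => N (h k)) fun k => f (h k) := by
  obtain ⟨c, hc⟩ := hf
  exact ⟨c, fun k => hc _⟩

end PolyBdd

/-- An expression that builds a given tree. -/
def Dat.toExp : Dat → Exp
  | .nil => .nil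
  | .cons a b => .cons a.toExp b.toExp

lemma Dat.eval_toExp (x : Dat) (σ : Store) : x.toExp.eval σ = x := by
  induction x with
  | nil => rfl
  | cons a b ha hb => simp [Dat.toExp, Exp.eval, ha, hb]

/-- Twice the number of leaves of a tree. -/
def Dat.weight : Dat → ℕ
  | .nil => 2
  | .cons a b => a.weight + b.weight

/-- The size of a value: twice the number of leaves of its encoding. -/
def sz {α : Type} [Code α] (a : α) : ℕ := (enc a).weight

section sz
variable {α β γ : Type} [Code α] [Code β] [Code γ]

lemma two_le_sz (a : α) : 2 ≤ sz a := by
  unfold sz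
  induction enc a with
  | nil => exact le_rfl
  | cons x y hx hy => simp only [Dat.weight]; omega

@[simp] lemma sz_prod (p : α × β) : sz p = sz p.1 + sz p.2 := rfl
@[simp] lemma sz_nil : sz ([] : List α) = 2 := rfl
@[simp] lemma sz_cons (a : α) (l : List α) : sz (a :: l) = sz a + sz l := rfl
@[simp] lemma sz_nat (n : ℕ) : sz n = 2 * n + 2 := by
  induction n with
  | zero => rfl
  | succ n ih =>
    change 2 + sz n = _
    omega
lemma sz_bool_le (b : Bool) : sz b ≤ 4 := by cases b <;> decide

@[simp] lemma sz_append (l l' : List α) : sz (l ++ l') + 2 = sz l + sz l' := by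
  induction l with
  | nil => simp; omega
  | cons a l ih => simp only [List.cons_append, sz_cons]; omega

lemma length_le_sz (l : List α) : l.length + 2 ≤ sz l := by
  induction l with
  | nil => simp
  | cons a l ih => have := two_le_sz a; simp; omega

lemma sz_le_of_mem {a : α} {l : List α} (h : a ∈ l) : sz a ≤ sz l := by
  induction l with
  | nil => simp at h
  | cons b l ih =>
    rcases List.mem_cons.1 h with rfl | h
    · simp
    · have := ih h; simp; omega

lemma sz_le_of_sublist {l l' : List α} (h : l.Sublist l') : sz l ≤ sz l' := by
  induction h with
  | slnil => exact le_rfl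
  | cons a _ ih => simp; omega
  | cons_cons a _ ih => simp; omega

lemma sz_reverse (l : List α) : sz l.reverse = sz l := by
  induction l with
  | nil => rfl
  | cons a l ih =>
    have := sz_append l.reverse [a]
    simp only [sz_cons, sz_nil, List.reverse_cons] at this ⊢
    omega

/-- A list whose entries have size at most `B`. -/
lemma sz_le_of_forall {l : List α} {B : ℕ} (h : ∀ a ∈ l, sz a ≤ B) : sz l ≤ l.length * B + 2 := by
  induction l with
  | nil => simp
  | cons a l ih =>
    have h1 := h a (by simp)
    have h2 := ih fun x hx => h x (by simp [hx])
    simp only [sz_cons, List.length_cons, Nat.succ_mul]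
    omega

/-- `f` is computable in time polynomial in the size of its argument, and its values have polynomial
size. (The second condition does not follow from the first: trees can share subtrees, so that
a short computation can yield a tree with exponentially many leaves.) -/
@[fun_prop]
def PolyTime (f : α → β) : Prop :=
  (∃ T, ComputesIn f T ∧ PolyBdd sz T) ∧ PolyBdd sz fun a => sz (f a)

lemma PolyBdd.sz_const (k : ℕ) : PolyBdd (sz : α → ℕ) fun _ => k := .const two_le_sz k

namespace PolyTime

lemma of_exp {f : α → β} (e : ℕ → Exp) (c : ℕ) (hc : ∀ d, (e d).cost ≤ c)
    (he : ∀ d σ a, σ d = enc a → (e d).eval σ = enc (f a)) (k : ℕ) (hf : ∀ a, sz (f a) ≤ sz a + k) :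
    PolyTime f :=
  ⟨⟨_, .of_exp e c hc he, .sz_const _⟩, (PolyBdd.self.add two_le_sz (.sz_const k)).mono hf⟩

@[fun_prop]
protected lemma id : PolyTime fun a : α => a :=
  of_exp (fun d => .var d) 1 (fun _ => le_rfl) (fun _ _ _ h => h) 0 fun _ => le_rfl

@[fun_prop]
lemma comp {g : β → γ} {f : α → β} (hg : PolyTime g) (hf : PolyTime f) :
    PolyTime fun a => g (f a) := by
  obtain ⟨⟨S, hS, bS⟩, sg⟩ := hg
  obtain ⟨⟨T, hT, bT⟩, sf⟩ := hf
  exact ⟨⟨_, hS.comp hT, bT.add two_le_sz ((bS.comp_right f).trans sf)⟩,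
    (sg.comp_right f).trans sf⟩

@[fun_prop]
lemma const (b : β) : PolyTime fun _ : α => b :=
  of_exp (fun _ => (enc b).toExp) _ (fun _ => le_rfl) (fun _ _ _ _ => Dat.eval_toExp _ _) (sz b)
    fun _ => by simp

@[fun_prop]
lemma fst {f : α → β × γ} (hf : PolyTime f) : PolyTime fun a => (f a).1 :=
  comp (g := fun p : β × γ => p.1) (of_exp (fun d => .hd (.var d)) 2 (fun _ => le_rfl)
    (fun _ _ _ h => by simp [Exp.eval, h, Dat.hd]) 0 fun _ => by simp) hf

@[fun_prop]
lemma snd {f : α → β × γ} (hf : PolyTime f) : PolyTime fun a => (f a).2 :=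
  comp (g := fun p : β × γ => p.2) (of_exp (fun d => .tl (.var d)) 2 (fun _ => le_rfl)
    (fun _ _ _ h => by simp [Exp.eval, h, Dat.tl]) 0 fun _ => by simp) hf

@[fun_prop]
lemma pair {f : α → β} {g : α → γ} (hf : PolyTime f) (hg : PolyTime g) :
    PolyTime fun a => (f a, g a) := by
  obtain ⟨⟨S, hS, bS⟩, sf⟩ := hf
  obtain ⟨⟨T, hT, bT⟩, sg⟩ := hg
  exact ⟨⟨_, hS.pair hT, (bS.add two_le_sz bT).add two_le_sz (.sz_const 8)⟩, sf.add two_le_sz sg⟩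

@[fun_prop]
lemma ite {c : α → Bool} {f g : α → β} (hc : PolyTime c) (hf : PolyTime f) (hg : PolyTime g) :
    PolyTime fun a => if c a then f a else g a := by
  obtain ⟨⟨R, hR, bR⟩, -⟩ := hc
  obtain ⟨⟨S, hS, bS⟩, sf⟩ := hf
  obtain ⟨⟨T, hT, bT⟩, sg⟩ := hg
  refine ⟨⟨_, hR.ite hS hT, ((bR.add two_le_sz (bS.add two_le_sz bT)).add two_le_sz
    (.sz_const 4)).mono fun a => ?_⟩, (sf.add two_le_sz sg).mono fun a => ?_⟩
  · split_ifs <;> omega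
  · beta_reduce
    split_ifs <;> omega

@[fun_prop]
lemma cons {f : α → β} {l : α → List β} (hf : PolyTime f) (hl : PolyTime l) :
    PolyTime fun a => f a :: l a :=
  comp (g := fun p : β × List β => p.1 :: p.2) (of_exp (fun d => .var d) 1 (fun _ => le_rfl)
    (fun _ _ _ h => h) 0 fun _ => by simp) (hf.pair hl)

@[fun_prop]
lemma tail {l : α → List β} (hl : PolyTime l) : PolyTime fun a => (l a).tail :=
  comp (g := fun l : List β => l.tail) (of_exp (fun d => .tl (.var d)) 2 (fun _ => le_rfl)
    (fun _ _ l h => by cases l <;> simp [Exp.eval, h, Dat.tl]) 0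
    fun l => sz_le_of_sublist (List.tail_sublist l)) hl

@[fun_prop]
lemma isEmpty {l : α → List β} (hl : PolyTime l) : PolyTime fun a => (l a).isEmpty :=
  comp (g := fun l : List β => l.isEmpty) ⟨⟨_, .isEmpty, .sz_const 6⟩,
    (PolyBdd.sz_const 4).mono fun _ => sz_bool_le _⟩ hl

/-- Loops over lists run in polynomial time, if the intermediate results have polynomial size. -/
lemma foldl {s : α → β → γ → β} {l : α → List γ} {b : α → β} {B : α → ℕ}
    (hs : PolyTime fun q : α × β × γ => s q.1 q.2.1 q.2.2) (hl : PolyTime l) (hb : PolyTime b)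
    (hB : PolyBdd sz B) (hsz : ∀ a l', l' <+: l a → sz (l'.foldl (s a) (b a)) ≤ B a) :
    PolyTime fun a => (l a).foldl (s a) (b a) := by
  obtain ⟨⟨S, hS, c, hc⟩, -⟩ := hs
  obtain ⟨⟨Tl, hTl, bTl⟩, sl⟩ := hl
  obtain ⟨⟨Tb, hTb, bTb⟩, sb⟩ := hb
  have key := hS.foldl (s := s) hTb hTl (B := fun a => (sz a + (B a + sz (l a))) ^ c)
    fun a l₁ x l₂ h =>
    (hc _).trans (Nat.pow_le_pow_left (by
      have h1 := hsz a l₁ ⟨x :: l₂, h.symm⟩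
      have h2 : sz x ≤ sz (l a) := sz_le_of_mem (by simp [h])
      simp only [sz_prod]
      omega) c)
  refine ⟨⟨_, key, ?_⟩, hB.mono fun a => hsz a (l a) List.prefix_rfl⟩
  refine ((bTb.add two_le_sz bTl).add two_le_sz (PolyBdd.mul ?_ ?_)).add two_le_sz (.sz_const 10)
  · exact sl.mono fun a => by have := length_le_sz (l a); omega
  · exact ((PolyBdd.self.add two_le_sz (hB.add two_le_sz sl)).pow c).add two_le_sz (.sz_const 14)

end PolyTime
end sz

/-! ### Polynomial-time operations on lists and numbers -/

/-- The maximum of a list of numbers (`0` for the empty list). -/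
def listMax (l : List ℕ) : ℕ := l.foldl max 0

namespace PolyTime
variable {α β γ : Type} [Code α] [Code β] [Code γ]

@[fun_prop]
lemma not {p : α → Bool} (hp : PolyTime p) : PolyTime fun a => !p a := by
  have : PolyTime fun a => if p a then false else true := by fun_prop
  convert this using 2 with a
  cases p a <;> rfl

@[fun_prop]
lemma and {p q : α → Bool} (hp : PolyTime p) (hq : PolyTime q) : PolyTime fun a => p a && q a := by
  have : PolyTime fun a => if p a then q a else false := by fun_prop
  convert this using 2 with a
  cases p a <;> rfl

@[fun_prop]
lemma or {p q : α → Bool} (hp : PolyTime p) (hq : PolyTime q) : PolyTime fun a => p a || q a := by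
  have : PolyTime fun a => if p a then true else q a := by fun_prop
  convert this using 2 with a
  cases p a <;> rfl

@[fun_prop]
lemma reverse {l : α → List β} (hl : PolyTime l) : PolyTime fun a => (l a).reverse := by
  have h (l l' : List β) : l.foldl (fun acc x => x :: acc) l' = l.reverse ++ l' := by
    induction l generalizing l' <;> simp [*]
  have : PolyTime fun a => (l a).foldl (fun acc x => x :: acc) [] := by
    refine foldl (s := fun _ acc x => x :: acc) (by fun_prop) hl (by fun_prop) hl.2
      fun a l' hl' => ?_
    rw [h, List.append_nil, sz_reverse]
    exact sz_le_of_sublist hl'.sublist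
  simpa [h] using this

@[fun_prop]
lemma map {l : α → List β} {g : α → β → γ} (hl : PolyTime l)
    (hg : PolyTime fun q : α × β => g q.1 q.2) : PolyTime fun a => (l a).map (g a) := by
  have h (a : α) (l : List β) (l' : List γ) :
      l.foldl (fun acc x => g a x :: acc) l' = (l.map (g a)).reverse ++ l' := by
    induction l generalizing l' <;> simp [*]
  have : PolyTime fun a => (l a).foldl (fun acc x => g a x :: acc) [] := by
    obtain ⟨c, hc⟩ := hg.2
    refine foldl (s := fun a acc x => g a x :: acc) (by fun_prop) hl (by fun_prop)
      (B := fun a => sz (l a) * (sz a + sz (l a)) ^ c + 2)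
      ((hl.2.mul ((PolyBdd.self.add two_le_sz hl.2).pow c)).add two_le_sz (.sz_const 2))
      fun a l' hl' => ?_
    rw [h, List.append_nil, sz_reverse]
    refine (sz_le_of_forall (B := (sz a + sz (l a)) ^ c) fun y hy => ?_).trans ?_
    · obtain ⟨x, hx, rfl⟩ := List.mem_map.1 hy
      exact (hc (a, x)).trans (Nat.pow_le_pow_left
        (Nat.add_le_add_left (sz_le_of_mem (hl'.subset hx)) _) c)
    · rw [List.length_map]
      gcongr
      exact hl'.length_le.trans (by have := length_le_sz (l a); omega)
  simpa [h] using this.reverse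

@[fun_prop]
lemma append {l l' : α → List β} (hl : PolyTime l) (hl' : PolyTime l') :
    PolyTime fun a => l a ++ l' a := by
  have h (l l' : List β) : l.foldl (fun acc x => x :: acc) l' = l.reverse ++ l' := by
    induction l generalizing l' <;> simp [*]
  have : PolyTime fun a => (l a).reverse.foldl (fun acc x => x :: acc) (l' a) := by
    refine foldl (s := fun _ acc x => x :: acc) (by fun_prop) (by fun_prop) (by fun_prop)
      (hl.2.add two_le_sz hl'.2) fun a m hm => ?_
    have h1 := sz_append m.reverse (l' a)
    have h2 := sz_le_of_sublist hm.sublist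
    rw [sz_reverse] at h1 h2
    rw [h]
    omega
  simpa [h] using this

@[fun_prop]
lemma flatten {l : α → List (List β)} (hl : PolyTime l) : PolyTime fun a => (l a).flatten := by
  have h (l : List (List β)) (l' : List β) :
      l.foldl (fun acc x => acc ++ x) l' = l' ++ l.flatten := by
    induction l generalizing l' <;> simp [*]
  have hs (l : List (List β)) : sz l.flatten ≤ sz l := by
    induction l with
    | nil => simp
    | cons x l ih => have := sz_append x l.flatten; simp; omega
  have : PolyTime fun a => (l a).foldl (fun acc x => acc ++ x) [] := by
    refine foldl (s := fun _ acc x => acc ++ x) (by fun_prop) hl (by fun_prop) hl.2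
      fun a l' hl' => ?_
    rw [h, List.nil_append]
    exact (hs l').trans (sz_le_of_sublist hl'.sublist)
  simpa [h] using this

@[fun_prop]
lemma flatMap {l : α → List β} {g : α → β → List γ} (hl : PolyTime l)
    (hg : PolyTime fun q : α × β => g q.1 q.2) : PolyTime fun a => (l a).flatMap (g a) := by
  have : PolyTime fun a => ((l a).map (g a)).flatten := by fun_prop
  simpa [List.flatMap] using this

@[fun_prop]
lemma filter {l : α → List β} {p : α → β → Bool} (hl : PolyTime l)
    (hp : PolyTime fun q : α × β => p q.1 q.2) : PolyTime fun a => (l a).filter (p a) := by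
  have : PolyTime fun a => (l a).flatMap (fun x => if p a x then [x] else []) := by fun_prop
  convert this using 2 with a
  induction l a with
  | nil => rfl
  | cons x l ih => by_cases h : p a x <;> simp [h, ih]

@[fun_prop]
lemma any {l : α → List β} {p : α → β → Bool} (hl : PolyTime l)
    (hp : PolyTime fun q : α × β => p q.1 q.2) : PolyTime fun a => (l a).any (p a) := by
  have : PolyTime fun a => !((l a).filter (p a)).isEmpty := by fun_prop
  convert this using 2 with a
  induction l a with
  | nil => rfl
  | cons x l ih => by_cases h : p a x <;> simp [h, ih]

@[fun_prop]
lemma all {l : α → List β} {p : α → β → Bool} (hl : PolyTime l)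
    (hp : PolyTime fun q : α × β => p q.1 q.2) : PolyTime fun a => (l a).all (p a) := by
  have : PolyTime fun a => !(l a).any (fun x => !p a x) := by fun_prop
  convert this using 2 with a
  simp [List.any_eq_not_all_not]

lemma headD_of_enc_eq_nil {b : β} (hb : enc b = .nil) {l : α → List β} (hl : PolyTime l) :
    PolyTime fun a => (l a).headD b :=
  comp (g := fun l : List β => l.headD b) (of_exp (fun d => .hd (.var d)) 2 (fun _ => le_rfl)
    (fun _ _ l h => by cases l <;> simp [Exp.eval, h, Dat.hd, hb]) 0
    fun l => by cases l <;> simp [sz, hb, Dat.weight]) hl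

/-- In the encoding, a number is a list of that length. -/
@[fun_prop]
lemma replicate {n : α → ℕ} (hn : PolyTime n) : PolyTime fun a => List.replicate (n a) () :=
  comp (g := fun n => List.replicate n ()) (of_exp (fun d => .var d) 1 (fun _ => le_rfl)
    (fun _ _ n h => by simp [Exp.eval, h, enc]) 0
    fun n => by simp [sz, enc]) hn

@[fun_prop]
lemma length {l : α → List β} (hl : PolyTime l) : PolyTime fun a => (l a).length := by
  have : PolyTime fun a => (l a).map (fun _ => ()) := by fun_prop
  have e (l : List Unit) : enc l = enc l.length := by
    induction l <;> simp [*]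
  have h : PolyTime fun l : List Unit => l.length :=
    of_exp (fun d => .var d) 1 (fun _ => le_rfl) (fun _ _ l h => h.trans (e l)) 0
      fun l => by simp [sz, e]
  simpa using h.comp this

@[fun_prop]
lemma succ {n : α → ℕ} (hn : PolyTime n) : PolyTime fun a => n a + 1 :=
  comp (g := fun n : ℕ => n + 1) (of_exp (fun d => .cons .nil (.var d)) 3 (fun _ => le_rfl)
    (fun _ _ n h => by simp [Exp.eval, h]) 2 fun n => by simp; omega) hn

@[fun_prop]
lemma pred {n : α → ℕ} (hn : PolyTime n) : PolyTime fun a => n a - 1 :=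
  comp (g := fun n : ℕ => n - 1) (of_exp (fun d => .tl (.var d)) 2 (fun _ => le_rfl)
    (fun _ _ n h => by cases n <;> simp [Exp.eval, h, Dat.tl]) 0 fun n => by simp) hn

@[fun_prop]
lemma sub {m n : α → ℕ} (hm : PolyTime m) (hn : PolyTime n) : PolyTime fun a => m a - n a := by
  have h (l : List Unit) (m : ℕ) : l.foldl (fun acc _ => acc - 1) m = m - l.length := by
    induction l generalizing m <;> simp [*]; omega
  have : PolyTime fun a => (List.replicate (n a) ()).foldl (fun acc _ => acc - 1) (m a) :=
    foldl (s := fun _ acc _ => acc - 1) (by fun_prop) (by fun_prop) hm hm.2 fun a l' _ => by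
      rw [h]; simp
  simpa [h] using this

@[fun_prop]
lemma add {m n : α → ℕ} (hm : PolyTime m) (hn : PolyTime n) : PolyTime fun a => m a + n a := by
  have h (l : List Unit) (m : ℕ) : l.foldl (fun acc _ => acc + 1) m = m + l.length := by
    induction l generalizing m <;> simp [*]; omega
  have : PolyTime fun a => (List.replicate (n a) ()).foldl (fun acc _ => acc + 1) (m a) :=
    foldl (s := fun _ acc _ => acc + 1) (by fun_prop) (by fun_prop) hm
      (hm.2.add two_le_sz hn.2) fun a l' hl' => by
        have := hl'.length_le
        simp only [List.length_replicate] at this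
        rw [h]
        simp
        omega
  simpa [h] using this

@[fun_prop]
lemma ble {m n : α → ℕ} (hm : PolyTime m) (hn : PolyTime n) :
    PolyTime fun a => decide (m a ≤ n a) := by
  have : PolyTime fun a => (List.replicate (m a - n a) ()).isEmpty := by fun_prop
  convert this using 2 with a
  rw [Bool.eq_iff_iff]
  simp [Nat.sub_eq_zero_iff_le]

@[fun_prop]
lemma beq {m n : α → ℕ} (hm : PolyTime m) (hn : PolyTime n) : PolyTime fun a => m a == n a := by
  have : PolyTime fun a => decide (m a ≤ n a) && decide (n a ≤ m a) := by fun_prop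
  convert this using 2 with a
  rw [Bool.eq_iff_iff, beq_iff_eq, le_antisymm_iff]
  simp

@[fun_prop]
lemma min {m n : α → ℕ} (hm : PolyTime m) (hn : PolyTime n) :
    PolyTime fun a => min (m a) (n a) := by
  have : PolyTime fun a => m a - (m a - n a) := by fun_prop
  convert this using 2 with a
  omega

@[fun_prop]
lemma max {m n : α → ℕ} (hm : PolyTime m) (hn : PolyTime n) :
    PolyTime fun a => max (m a) (n a) := by
  have : PolyTime fun a => m a + (n a - m a) := by fun_prop
  convert this using 2 with a
  omega

@[fun_prop]
lemma listMax {l : α → List ℕ} (hl : PolyTime l) : PolyTime fun a => listMax (l a) := by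
  have h (l : List ℕ) (m : ℕ) : sz (l.foldl Max.max m) ≤ sz m + sz l := by
    induction l generalizing m with
    | nil => simp
    | cons x l ih =>
      refine (ih _).trans ?_
      simp
      omega
  exact foldl (s := fun _ => Max.max) (by fun_prop) hl (by fun_prop)
    (hl.2.add two_le_sz (.sz_const 2)) fun a l' hl' => (h l' 0).trans (by
      have := sz_le_of_sublist hl'.sublist
      simp; omega)

@[fun_prop]
lemma drop {l : α → List β} {n : α → ℕ} (hl : PolyTime l) (hn : PolyTime n) :
    PolyTime fun a => (l a).drop (n a) := by
  have h (m : List Unit) (l : List β) : m.foldl (fun acc _ => acc.tail) l = l.drop m.length := by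
    induction m generalizing l with
    | nil => rfl
    | cons x m ih => cases l <;> simp [ih]
  have : PolyTime fun a => (List.replicate (n a) ()).foldl (fun acc _ => acc.tail) (l a) :=
    foldl (s := fun _ acc _ => acc.tail) (by fun_prop) (by fun_prop) hl hl.2 fun a l' _ => by
      rw [h]; exact sz_le_of_sublist (List.drop_sublist _ _)
  simpa [h] using this

@[fun_prop]
lemma getD_false {l : α → List Bool} {n : α → ℕ} (hl : PolyTime l) (hn : PolyTime n) :
    PolyTime fun a => (l a).getD (n a) false := by
  have := headD_of_enc_eq_nil (b := false) rfl (hl.drop hn)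
  simpa [List.headD_eq_head?_getD, List.head?_drop] using this

@[fun_prop]
lemma getD_nil {l : α → List (List β)} {n : α → ℕ} (hl : PolyTime l) (hn : PolyTime n) :
    PolyTime fun a => (l a).getD (n a) [] := by
  have := headD_of_enc_eq_nil (b := ([] : List β)) rfl (hl.drop hn)
  simpa [List.headD_eq_head?_getD, List.head?_drop] using this

@[fun_prop]
lemma headD_zero {l : α → List ℕ} (hl : PolyTime l) : PolyTime fun a => (l a).headD 0 :=
  headD_of_enc_eq_nil rfl hl

end PolyTime

/-! ### The algorithm for a fixed width -/

/-- The entry of the adjacency matrix `A` at `(u, v)` (`false` outside the matrix). -/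
def adj (A : List (List Bool)) (u v : ℕ) : Bool := (A.getD u []).getD v false

/-- The elements of `S` that are not in `Z`. -/
def listDiff (S Z : List ℕ) : List ℕ := S.filter fun v => !Z.any fun x => x == v

/-- The test for `R ⊆ S`. -/
def isSubset (R S : List ℕ) : Bool := R.all fun v => S.any fun x => x == v

/-- The test for `R ∩ S ≠ ∅`. -/
def meets (R S : List ℕ) : Bool := R.any fun v => S.any fun x => x == v

/-- The vertices of `S` reachable from `v ∈ S` within `S`: in each of `S.length` rounds, the
neighbours are added. -/
def reach (A : List (List Bool)) (S : List ℕ) (v : ℕ) : List ℕ :=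
  S.foldl (fun R _ => S.filter fun u => R.any fun x => x == u || adj A x u) [v]

/-- The values that a table of values `T` lists for the set `R`. -/
def lookup (T : List (List ℕ × ℕ)) (R : List ℕ) : List ℕ :=
  (T.filter fun e => isSubset e.1 R && isSubset R e.1).map fun e => e.2

/-- One step of `split`: a component is removed from the set of remaining vertices. -/
def splitStep (A : List (List Bool)) (T : List (List ℕ × ℕ)) (s : List ℕ × Bool × ℕ) :
    List ℕ × Bool × ℕ :=
  if s.1.isEmpty then s else
    (listDiff s.1 (reach A s.1 (s.1.headD 0)),
      s.2.1 && !(lookup T (reach A s.1 (s.1.headD 0))).isEmpty,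
      s.2.2 + (lookup T (reach A s.1 (s.1.headD 0))).headD 0)

/-- Whether all components of `S` are listed in the table `T`, and the sum of their values. -/
def split (A : List (List Bool)) (T : List (List ℕ × ℕ)) (S : List ℕ) : Bool × ℕ :=
  (S.foldl (fun s _ => splitStep A T s) (S, true, 0)).2

/-- What remains of `R` if the sets listed in `X` and `Q` are removed. -/
def remove (R : List ℕ) (X Q : List (List ℕ)) : List ℕ := listDiff R (X.flatten ++ Q.flatten)

/-- The sets that are listed in `Q` are contained in `R` and meet the union of `X`. -/
def isValid (R : List ℕ) (X Q : List (List ℕ)) : Bool :=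
  Q.all fun q => isSubset q R && meets q X.flatten

/-- For `R` in `K`, the value of `R` is determined with the help of a separator `X` in `𝒰`, provided
that for every valid choice `Q` of members meeting `X`, the components of what remains have
values in the table `T`. Values are cut off at `cap`. -/
def nextTable (A : List (List Bool)) (cap : ℕ) (𝒰 𝒬 : List (List (List ℕ))) (K : List (List ℕ))
    (T : List (List ℕ × ℕ)) : List (List ℕ × ℕ) :=
  K.flatMap fun R =>
    (𝒰.filter fun X => (𝒬.filter fun Q => isValid R X Q).all fun Q =>
      (split A T (remove R X Q)).1).map
    fun X => (R, min cap (listMax ((𝒬.filter fun Q => isValid R X Q).map fun Q =>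
      Q.length + (split A T (remove R X Q)).2)))

/-- The sets for which values are computed: the components that arise if one set of separating
vertices and one set of members are removed. -/
def keys (A : List (List Bool)) (V : List ℕ) (𝒰 𝒬 : List (List (List ℕ))) : List (List ℕ) :=
  𝒰.flatMap fun X => 𝒬.flatMap fun Q => (remove V X Q).map fun v => reach A (remove V X Q) v

/-- The table after `l.length` rounds. -/
def table (A : List (List Bool)) (V : List ℕ) (cap : ℕ) (𝒰 𝒬 : List (List (List ℕ))) (l : List ℕ) :
    List (List ℕ × ℕ) :=
  l.foldl (fun T _ => nextTable A cap 𝒰 𝒬 (keys A V 𝒰 𝒬) T) []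

/-- Whether the computation succeeds with the separators in `𝒰` and the families in `𝒬`, and if so,
the maximum size of a packing. -/
def solve (A : List (List Bool)) (V : List ℕ) (cap : ℕ) (𝒰 𝒬 : List (List (List ℕ))) : Bool × ℕ :=
  split A (table A V cap 𝒰 𝒬 V) V

/-- The lists of at most `w + 1` pairwise disjoint sets in `M`, if `𝒬` contains those of at
most `w`. -/
def extend (M : List (List ℕ)) (𝒬 : List (List (List ℕ))) : List (List (List ℕ)) :=
  [] :: M.flatMap fun q => (𝒬.filter fun Q => Q.all fun q' => !meets q q').map fun Q => q :: Q

namespace PolyTime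
variable {α : Type} [Code α] {A : α → List (List Bool)} {R S Z V : α → List ℕ} {u v cap : α → ℕ}
  {T : α → List (List ℕ × ℕ)} {s : α → List ℕ × Bool × ℕ} {X Q M K : α → List (List ℕ)}
  {𝒰 𝒬 : α → List (List (List ℕ))}

@[fun_prop]
lemma adj (hA : PolyTime A) (hu : PolyTime u) (hv : PolyTime v) :
    PolyTime fun a => adj (A a) (u a) (v a) := by
  unfold ListPacking.adj; fun_prop

@[fun_prop]
lemma listDiff (hS : PolyTime S) (hZ : PolyTime Z) :
    PolyTime fun a => listDiff (S a) (Z a) := by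
  unfold ListPacking.listDiff; fun_prop

@[fun_prop]
lemma isSubset (hR : PolyTime R) (hS : PolyTime S) : PolyTime fun a => isSubset (R a) (S a) := by
  unfold ListPacking.isSubset; fun_prop

@[fun_prop]
lemma meets (hR : PolyTime R) (hS : PolyTime S) : PolyTime fun a => meets (R a) (S a) := by
  unfold ListPacking.meets; fun_prop

@[fun_prop]
lemma reach (hA : PolyTime A) (hS : PolyTime S) (hv : PolyTime v) :
    PolyTime fun a => reach (A a) (S a) (v a) := by
  unfold ListPacking.reach
  refine foldl (s := fun a R _ => (S a).filter fun u =>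
      R.any fun x => x == u || ListPacking.adj (A a) x u)
    (by fun_prop) hS (by fun_prop) (B := fun a => sz (S a) + sz [v a])
    (hS.2.add two_le_sz (show PolyTime fun a => [v a] by fun_prop).2) fun a l' _ => ?_
  rcases l'.eq_nil_or_concat' with rfl | ⟨l, x, rfl⟩
  · simp
  · rw [List.foldl_append, List.foldl_cons, List.foldl_nil]
    exact (sz_le_of_sublist List.filter_sublist).trans (Nat.le_add_right _ _)

@[fun_prop]
lemma lookup (hT : PolyTime T) (hR : PolyTime R) : PolyTime fun a => lookup (T a) (R a) := by
  unfold ListPacking.lookup; fun_prop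

@[fun_prop]
lemma splitStep (hA : PolyTime A) (hT : PolyTime T) (hs : PolyTime s) :
    PolyTime fun a => splitStep (A a) (T a) (s a) := by
  unfold ListPacking.splitStep; fun_prop

lemma sz_headD_lookup_le (T : List (List ℕ × ℕ)) (R : List ℕ) :
    (ListPacking.lookup T R).headD 0 ≤ sz T := by
  unfold ListPacking.lookup
  rcases h : T.filter fun e => ListPacking.isSubset e.1 R && ListPacking.isSubset R e.1
    with _ | ⟨e, l⟩
  · rw [h]
    exact Nat.zero_le _
  · rw [h]
    have he : e ∈ T := (List.mem_filter.1 (h ▸ List.mem_cons_self)).1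
    have := sz_le_of_mem he
    simp only [sz_prod, sz_nat, List.map_cons, List.headD_cons] at this ⊢
    omega

@[fun_prop]
lemma split (hA : PolyTime A) (hT : PolyTime T) (hS : PolyTime S) :
    PolyTime fun a => split (A a) (T a) (S a) := by
  unfold ListPacking.split
  refine snd (foldl (s := fun a s _ => ListPacking.splitStep (A a) (T a) s) (by fun_prop) hS
    (by fun_prop) (B := fun a => sz (S a) + (4 + (2 * (sz (S a) * sz (T a)) + 2)))
    (hS.2.add two_le_sz ((PolyBdd.sz_const 4).add two_le_sz (((PolyBdd.sz_const 2).mul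
      (hS.2.mul hT.2)).add two_le_sz (.sz_const 2)))) fun a l' hl' => ?_)
  have key (l : List ℕ) (s : List ℕ × Bool × ℕ) (hs : s.1.Sublist (S a)) :
      (l.foldl (fun s _ => ListPacking.splitStep (A a) (T a) s) s).1.Sublist (S a) ∧
      (l.foldl (fun s _ => ListPacking.splitStep (A a) (T a) s) s).2.2 ≤
        s.2.2 + l.length * sz (T a) := by
    induction l generalizing s with
    | nil => exact ⟨hs, by simp⟩
    | cons x l ih =>
      have h : (ListPacking.splitStep (A a) (T a) s).1.Sublist (S a) ∧
          (ListPacking.splitStep (A a) (T a) s).2.2 ≤ s.2.2 + sz (T a) := by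
        unfold ListPacking.splitStep
        split_ifs
        · exact ⟨hs, Nat.le_add_right _ _⟩
        · exact ⟨List.filter_sublist.trans hs, Nat.add_le_add_left (sz_headD_lookup_le _ _) _⟩
      obtain ⟨h1, h2⟩ := ih _ h.1
      refine ⟨h1, h2.trans ?_⟩
      rw [List.length_cons, Nat.succ_mul]
      omega
  obtain ⟨h1, h2⟩ := key l' (S a, true, 0) (List.Sublist.refl _)
  have h3 := sz_le_of_sublist h1
  have h4 := sz_bool_le
    (l'.foldl (fun s _ => ListPacking.splitStep (A a) (T a) s) (S a, true, 0)).2.1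
  have h5 : l'.length * sz (T a) ≤ sz (S a) * sz (T a) := by
    have := hl'.length_le
    have := length_le_sz (S a)
    gcongr
    omega
  simp only [sz_prod, sz_nat, Nat.zero_add] at h2 ⊢
  omega

@[fun_prop]
lemma remove (hR : PolyTime R) (hX : PolyTime X) (hQ : PolyTime Q) :
    PolyTime fun a => remove (R a) (X a) (Q a) := by
  unfold ListPacking.remove; fun_prop

@[fun_prop]
lemma isValid (hR : PolyTime R) (hX : PolyTime X) (hQ : PolyTime Q) :
    PolyTime fun a => isValid (R a) (X a) (Q a) := by
  unfold ListPacking.isValid; fun_prop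

@[fun_prop]
lemma nextTable (hA : PolyTime A) (hcap : PolyTime cap) (h𝒰 : PolyTime 𝒰) (h𝒬 : PolyTime 𝒬)
    (hK : PolyTime K) (hT : PolyTime T) :
    PolyTime fun a => nextTable (A a) (cap a) (𝒰 a) (𝒬 a) (K a) (T a) := by
  unfold ListPacking.nextTable; fun_prop

@[fun_prop]
lemma keys (hA : PolyTime A) (hV : PolyTime V) (h𝒰 : PolyTime 𝒰) (h𝒬 : PolyTime 𝒬) :
    PolyTime fun a => keys (A a) (V a) (𝒰 a) (𝒬 a) := by
  unfold ListPacking.keys; fun_prop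

/-- The size of the table does not grow with the number of rounds, since values are cut off. -/
lemma sz_nextTable_le (A : List (List Bool)) (cap : ℕ) (𝒰 𝒬 : List (List (List ℕ)))
    (K : List (List ℕ)) (T : List (List ℕ × ℕ)) :
    sz (ListPacking.nextTable A cap 𝒰 𝒬 K T) ≤ sz K * sz 𝒰 * (sz K + sz cap) + 2 := by
  refine (sz_le_of_forall (B := sz K + sz cap) fun e he => ?_).trans ?_
  · simp only [ListPacking.nextTable, List.mem_flatMap, List.mem_map] at he
    obtain ⟨R, hR, X, -, rfl⟩ := he
    have := sz_le_of_mem hR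
    simp only [sz_prod, sz_nat]
    omega
  · gcongr
    rw [ListPacking.nextTable, List.length_flatMap]
    refine (List.sum_le_card_nsmul _ (sz 𝒰) fun m hm => ?_).trans ?_
    · obtain ⟨R, -, rfl⟩ := List.mem_map.1 hm
      rw [List.length_map]
      exact (List.length_filter_le _ _).trans (by have := length_le_sz 𝒰; omega)
    · rw [List.length_map, smul_eq_mul]
      gcongr
      have := length_le_sz K
      omega

@[fun_prop]
lemma table (hA : PolyTime A) (hV : PolyTime V) (hcap : PolyTime cap) (h𝒰 : PolyTime 𝒰)
    (h𝒬 : PolyTime 𝒬) (hS : PolyTime S) :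
    PolyTime fun a => table (A a) (V a) (cap a) (𝒰 a) (𝒬 a) (S a) := by
  have hK := hA.keys hV h𝒰 h𝒬
  unfold ListPacking.table
  refine foldl (s := fun a T _ => ListPacking.nextTable (A a) (cap a) (𝒰 a) (𝒬 a)
      (ListPacking.keys (A a) (V a) (𝒰 a) (𝒬 a)) T) (by fun_prop) hS (by fun_prop)
    (((hK.2.mul h𝒰.2).mul (hK.2.add two_le_sz hcap.2)).add two_le_sz (.sz_const 2)) fun a l' _ => ?_
  rcases l'.eq_nil_or_concat' with rfl | ⟨l, x, rfl⟩
  · simp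
  · rw [List.foldl_append, List.foldl_cons, List.foldl_nil]
    exact sz_nextTable_le _ _ _ _ _ _

@[fun_prop]
lemma solve (hA : PolyTime A) (hV : PolyTime V) (hcap : PolyTime cap) (h𝒰 : PolyTime 𝒰)
    (h𝒬 : PolyTime 𝒬) : PolyTime fun a => solve (A a) (V a) (cap a) (𝒰 a) (𝒬 a) := by
  unfold ListPacking.solve; fun_prop

@[fun_prop]
lemma extend (hM : PolyTime M) (h𝒬 : PolyTime 𝒬) : PolyTime fun a => extend (M a) (𝒬 a) := by
  unfold ListPacking.extend; fun_prop

end PolyTime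

/-! ### Components and packings -/

section Components
variable {E : ℕ → ℕ → Prop} {S D D' F R : Finset ℕ} {v x y : ℕ}

/-- `D` is nonempty and induces a connected subgraph of the graph with adjacency relation `E`:
no proper nonempty subset is closed under adjacency. -/
def Conn (E : ℕ → ℕ → Prop) (D : Finset ℕ) : Prop :=
  D.Nonempty ∧ ∀ T ⊆ D, T.Nonempty → (∀ x ∈ T, ∀ y ∈ D, E x y → y ∈ T) → T = D

/-- `D` is the vertex set of a connected component of the graph that `S` induces. -/
structure IsComp (E : ℕ → ℕ → Prop) (S D : Finset ℕ) : Prop where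
  subset : D ⊆ S
  conn : Conn E D
  closed : ∀ x ∈ D, ∀ y ∈ S, E x y → y ∈ D

lemma Conn.subset_or_disjoint (hF : Conn E F) (hFS : F ⊆ S)
    (hD : ∀ x ∈ D, ∀ y ∈ S, E x y → y ∈ D) : F ⊆ D ∨ Disjoint F D := by
  rw [or_iff_not_imp_right]
  intro h
  have : F ∩ D = F := hF.2 _ Finset.inter_subset_left (Finset.not_disjoint_iff_nonempty_inter.1 h)
    fun x hx y hy hxy => by
      rw [Finset.mem_inter] at hx ⊢
      exact ⟨hy, hD x hx.2 y (hFS hy) hxy⟩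
  exact Finset.inter_eq_left.1 this

lemma Conn.isComp_self (h : Conn E D) : IsComp E D D := ⟨subset_rfl, h, fun _ _ _ hy _ => hy⟩

lemma IsComp.eq_of_mem (h : IsComp E S D) (h' : IsComp E S D') (hx : x ∈ D) (hx' : x ∈ D') :
    D = D' := by
  have h1 := (h.conn.subset_or_disjoint h.subset h'.closed).resolve_right
    fun hd => Finset.disjoint_left.1 hd hx hx'
  have h2 := (h'.conn.subset_or_disjoint h'.subset h.closed).resolve_right
    fun hd => Finset.disjoint_left.1 hd hx' hx
  exact h1.antisymm h2

/-- A component of a union of components is a component. -/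
lemma IsComp.of_closed (h : IsComp E R D) (hR : R ⊆ S) (hc : ∀ x ∈ R, ∀ y ∈ S, E x y → y ∈ R) :
    IsComp E S D :=
  ⟨h.subset.trans hR, h.conn, fun x hx y hy hxy =>
    h.closed x hx y (hc x (h.subset hx) y hy hxy) hxy⟩

/-- If a component is removed, no edge leads back to it. -/
lemma IsComp.closed_sdiff (hE : ∀ x y, E x y → E y x) (h : IsComp E S D) :
    ∀ x ∈ S \ D, ∀ y ∈ S, E x y → y ∈ S \ D := fun x hx y hy hxy => by
  rw [Finset.mem_sdiff] at hx ⊢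
  exact ⟨hy, fun hyD => hx.2 (h.closed y hyD x hx.1 (hE _ _ hxy))⟩

lemma conn_singleton (v : ℕ) : Conn E {v} :=
  ⟨Finset.singleton_nonempty v, fun _ hT hne _ => (Finset.subset_singleton_iff.1 hT).resolve_left
    hne.ne_empty⟩

/-- A connected set remains connected if some vertices adjacent to it are added. -/
lemma Conn.extend (hE : ∀ x y, E x y → E y x) (hR : Conn E R) (hRS : R ⊆ S)
    (hS : ∀ y ∈ S, y ∈ R ∨ ∃ x ∈ R, E x y) : Conn E S := by
  refine ⟨hR.1.mono hRS, fun T hT hne hcl => hT.antisymm ?_⟩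
  have hne' : (T ∩ R).Nonempty := by
    obtain ⟨y, hy⟩ := hne
    rcases hS y (hT hy) with h | ⟨x, hx, hxy⟩
    · exact ⟨y, Finset.mem_inter.2 ⟨hy, h⟩⟩
    · exact ⟨x, Finset.mem_inter.2 ⟨hcl y hy x (hRS hx) (hE _ _ hxy), hx⟩⟩
  have hTR : T ∩ R = R := hR.2 _ Finset.inter_subset_right hne' fun x hx y hy hxy =>
    Finset.mem_inter.2 ⟨hcl x (Finset.mem_inter.1 hx).1 y (hRS hy) hxy, hy⟩
  have hRT : R ⊆ T := Finset.inter_eq_right.1 hTR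
  intro y hy
  rcases hS y hy with h | ⟨x, hx, hxy⟩
  · exact hRT h
  · exact hcl x (hRT hx) y hy hxy

/-- A family of pairwise disjoint members of `𝓜` contained in `S`. -/
structure IsPacking (𝓜 : Finset (Finset ℕ)) (S : Finset ℕ) (P : Finset (Finset ℕ)) : Prop where
  mem : ∀ F ∈ P, F ∈ 𝓜
  subset : ∀ F ∈ P, F ⊆ S
  disjoint : ∀ F ∈ P, ∀ F' ∈ P, F ≠ F' → Disjoint F F'

/-- `j` is the maximum size of a packing in `S`. -/
def IsOpt (𝓜 : Finset (Finset ℕ)) (S : Finset ℕ) (j : ℕ) : Prop :=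
  IsGreatest {j | ∃ P, IsPacking 𝓜 S P ∧ P.card = j} j

variable {𝓜 P P' Q : Finset (Finset ℕ)} {X : Finset ℕ} {i j : ℕ}

lemma IsPacking.mono (h : IsPacking 𝓜 S P) (hP : P' ⊆ P) (hS : ∀ F ∈ P', F ⊆ R) :
    IsPacking 𝓜 R P' :=
  ⟨fun F hF => h.mem F (hP hF), hS, fun F hF F' hF' => h.disjoint F (hP hF) F' (hP hF')⟩

lemma IsPacking.union (h : IsPacking 𝓜 S P) (h' : IsPacking 𝓜 S P')
    (hd : ∀ F ∈ P, ∀ F' ∈ P', Disjoint F F') : IsPacking 𝓜 S (P ∪ P') := by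
  refine ⟨fun F hF => ?_, fun F hF => ?_, fun F hF F' hF' hne => ?_⟩
  · exact (Finset.mem_union.1 hF).elim (h.mem F) (h'.mem F)
  · exact (Finset.mem_union.1 hF).elim (h.subset F) (h'.subset F)
  · rcases Finset.mem_union.1 hF with hF | hF <;> rcases Finset.mem_union.1 hF' with hF' | hF'
    · exact h.disjoint F hF F' hF' hne
    · exact hd F hF F' hF'
    · exact (hd F' hF' F hF).symm
    · exact h'.disjoint F hF F' hF' hne

lemma disjoint_of_forall_disjoint (hne : ∀ F ∈ P, F.Nonempty)
    (hd : ∀ F ∈ P, ∀ F' ∈ P', Disjoint F F') : Disjoint P P' :=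
  Finset.disjoint_left.2 fun F hF hF' =>
    (hne F hF).ne_empty (disjoint_self.1 (hd F hF F hF'))

lemma isOpt_empty (h𝓜 : ∀ F ∈ 𝓜, Conn E F) : IsOpt 𝓜 ∅ 0 := by
  refine ⟨⟨∅, ⟨by simp, by simp, by simp⟩, rfl⟩, ?_⟩
  rintro _ ⟨P, hP, rfl⟩
  rw [Nat.le_zero, Finset.card_eq_zero, Finset.eq_empty_iff_forall_notMem]
  exact fun F hF => (h𝓜 F (hP.mem F hF)).1.ne_empty (Finset.subset_empty.1 (hP.subset F hF))

lemma IsOpt.le_card (h : IsOpt 𝓜 S j) : j ≤ 𝓜.card := by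
  obtain ⟨⟨P, hP, rfl⟩, -⟩ := h
  exact Finset.card_le_card hP.mem

/-- Members are connected, so a packing in `S` splits along components. -/
lemma IsOpt.add (h𝓜 : ∀ F ∈ 𝓜, Conn E F) (hD : IsComp E S D) (hi : IsOpt 𝓜 D i)
    (hj : IsOpt 𝓜 (S \ D) j) : IsOpt 𝓜 S (i + j) := by
  constructor
  · obtain ⟨⟨P, hP, rfl⟩, -⟩ := hi
    obtain ⟨⟨P', hP', rfl⟩, -⟩ := hj
    have hd : ∀ F ∈ P, ∀ F' ∈ P', Disjoint F F' := fun F hF F' hF' =>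
      Finset.disjoint_sdiff.mono (hP.subset F hF) (hP'.subset F' hF')
    exact ⟨P ∪ P', (hP.mono subset_rfl fun F hF => (hP.subset F hF).trans hD.subset).union
      (hP'.mono subset_rfl fun F hF => (hP'.subset F hF).trans Finset.sdiff_subset) hd,
      Finset.card_union_of_disjoint (disjoint_of_forall_disjoint
        (fun F hF => (h𝓜 F (hP.mem F hF)).1) hd)⟩
  · rintro _ ⟨P, hP, rfl⟩
    rw [← Finset.card_filter_add_card_filter_not (fun F => F ⊆ D)]
    refine Nat.add_le_add (hi.2 ⟨_, hP.mono (Finset.filter_subset _ _) fun F hF =>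
      (Finset.mem_filter.1 hF).2, rfl⟩) (hj.2 ⟨_, hP.mono (Finset.filter_subset _ _) fun F hF => ?_,
      rfl⟩)
    obtain ⟨hF, hFD⟩ := Finset.mem_filter.1 hF
    have := ((h𝓜 F (hP.mem F hF)).subset_or_disjoint (hP.subset F hF) hD.closed).resolve_left hFD
    exact Finset.subset_sdiff.2 ⟨hP.subset F hF, this⟩

/-- At most `|X|` members of a packing meet `X`. -/
lemma IsPacking.card_le (hP : IsPacking 𝓜 S P) (hX : ∀ F ∈ P, ¬ Disjoint F X) :
    P.card ≤ X.card := by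
  have h : ∀ F : Finset ℕ, ∃ x, F ∈ P → x ∈ F ∧ x ∈ X := fun F => by
    by_cases hF : F ∈ P
    · obtain ⟨x, h1, h2⟩ := Finset.not_disjoint_iff.1 (hX F hF)
      exact ⟨x, fun _ => ⟨h1, h2⟩⟩
    · exact ⟨0, fun h => (hF h).elim⟩
  choose f hf using h
  refine Finset.card_le_card_of_injOn f (fun F hF => (hf F hF).2) fun F hF F' hF' hFF' => ?_
  by_contra hne
  exact Finset.disjoint_left.1 (hP.disjoint F hF F' hF' hne) (hf F hF).1
    (hFF' ▸ (hf F' hF').1)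

/-- The union of a family. -/
abbrev cover (Q : Finset (Finset ℕ)) : Finset ℕ := Q.sup id

lemma disjoint_cover : Disjoint S (cover Q) ↔ ∀ F ∈ Q, Disjoint S F := by
  rw [Finset.disjoint_sup_right]; rfl

/-- The recursion for the maximum size of a packing: guess the members `Q` that meet `X`. -/
lemma isOpt_of_separator (h𝓜 : ∀ F ∈ 𝓜, Conn E F)
    (hle : ∀ Q, IsPacking 𝓜 R Q → (∀ F ∈ Q, ¬ Disjoint F X) →
      ∃ i, IsOpt 𝓜 (R \ (X ∪ cover Q)) i ∧ Q.card + i ≤ j)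
    (hex : ∃ Q i, IsPacking 𝓜 R Q ∧ IsOpt 𝓜 (R \ (X ∪ cover Q)) i ∧ Q.card + i = j) :
    IsOpt 𝓜 R j := by
  constructor
  · obtain ⟨Q, i, hQ, ⟨⟨P, hP, rfl⟩, -⟩, rfl⟩ := hex
    have hd : ∀ F ∈ Q, ∀ F' ∈ P, Disjoint F F' := fun F hF F' hF' => by
      have := Finset.disjoint_union_right.1 (Finset.subset_sdiff.1 (hP.subset F' hF')).2
      exact (disjoint_cover.1 this.2 F hF).symm
    exact ⟨Q ∪ P, hQ.union (hP.mono subset_rfl fun F hF => (hP.subset F hF).trans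
      Finset.sdiff_subset) hd, Finset.card_union_of_disjoint (disjoint_of_forall_disjoint
        (fun F hF => (h𝓜 F (hQ.mem F hF)).1) hd)⟩
  · rintro _ ⟨P, hP, rfl⟩
    rw [← Finset.card_filter_add_card_filter_not (fun F => ¬ Disjoint F X)]
    have hQ := hP.mono (P' := P.filter fun F => ¬ Disjoint F X) (Finset.filter_subset _ _)
      fun F hF => hP.subset F (Finset.filter_subset _ _ hF)
    obtain ⟨i, hi, hij⟩ := hle _ hQ fun F hF => (Finset.mem_filter.1 hF).2
    refine (Nat.add_le_add_left (hi.2 ⟨_, hP.mono (Finset.filter_subset _ _) fun F hF => ?_, rfl⟩)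
      _).trans hij
    obtain ⟨hF, hFX⟩ := Finset.mem_filter.1 hF
    rw [not_not] at hFX
    refine Finset.subset_sdiff.2 ⟨hP.subset F hF, Finset.disjoint_union_right.2 ⟨hFX,
      disjoint_cover.2 fun F' hF' => ?_⟩⟩
    obtain ⟨hF', hFX'⟩ := Finset.mem_filter.1 hF'
    exact hP.disjoint F hF F' hF' fun h => hFX' (h ▸ hFX)

end Components

/-! ### Correctness of the algorithm -/

variable {A : List (List Bool)} {R S V Z l : List ℕ} {X Q M : List (List ℕ)}
  {𝒰 𝒬 : List (List (List ℕ))} {T : List (List ℕ × ℕ)} {v cap k : ℕ} {𝓜 : Finset (Finset ℕ)}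

lemma mem_listDiff : v ∈ listDiff S Z ↔ v ∈ S ∧ v ∉ Z := by
  simp [listDiff]
  grind

lemma toFinset_listDiff : (listDiff S Z).toFinset = S.toFinset \ Z.toFinset := by
  ext; simp [mem_listDiff]

lemma isSubset_iff : isSubset R S = true ↔ R.toFinset ⊆ S.toFinset := by
  simp [isSubset, Finset.subset_iff]

lemma meets_iff : meets R S = true ↔ ¬ Disjoint R.toFinset S.toFinset := by
  rw [Finset.not_disjoint_iff]
  simp [meets]

lemma meets_eq_false_iff : meets R S = false ↔ Disjoint R.toFinset S.toFinset := by
  rw [← not_iff_not, ← meets_iff, Bool.not_eq_false]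

/-- The union of a list of sets. -/
abbrev listCover (Q : List (List ℕ)) : Finset ℕ := Q.flatten.toFinset

/-- The sets that are listed in `Q`. -/
abbrev family (Q : List (List ℕ)) : Finset (Finset ℕ) := (Q.map List.toFinset).toFinset

lemma mem_family {F : Finset ℕ} : F ∈ family Q ↔ ∃ q ∈ Q, q.toFinset = F := by simp

lemma cover_family : cover (family Q) = listCover Q := by
  ext x
  simp [Finset.mem_sup]

lemma toFinset_remove :
    (remove R X Q).toFinset = R.toFinset \ (listCover X ∪ cover (family Q)) := by
  rw [remove, toFinset_listDiff, cover_family, List.toFinset_append]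

lemma mem_lookup {j : ℕ} :
    j ∈ lookup T R ↔ ∃ R', (R', j) ∈ T ∧ R'.toFinset = R.toFinset := by
  simp only [lookup, List.mem_map, List.mem_filter, Bool.and_eq_true, isSubset_iff, Prod.exists,
    ← Finset.Subset.antisymm_iff]
  grind

/-- The graph of the adjacency matrix. -/
abbrev Edge (A : List (List Bool)) (u v : ℕ) : Prop := adj A u v = true

lemma reach_spec (hE : ∀ x y, Edge A x y → Edge A y x) (hv : v ∈ S) :
    IsComp (Edge A) S.toFinset (reach A S v).toFinset ∧ v ∈ reach A S v := by
  let g : List ℕ → List ℕ := fun R => S.filter fun u => R.any fun x => x == u || adj A x u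
  have mem_g (R : List ℕ) (u : ℕ) : u ∈ g R ↔ u ∈ S ∧ (u ∈ R ∨ ∃ x ∈ R, Edge A x u) := by
    simp only [g, List.mem_filter, List.any_eq_true, Bool.or_eq_true, beq_iff_eq, Edge]
    grind
  -- a round in which nothing is added reaches a closed set, so `S.length` rounds suffice
  have key : ∀ (l : List ℕ) (R : List ℕ), R ⊆ S → v ∈ R → Conn (Edge A) R.toFinset →
      S.length < R.toFinset.card + l.length →
      (l.foldl (fun R _ => g R) R ⊆ S ∧ v ∈ l.foldl (fun R _ => g R) R ∧
        Conn (Edge A) (l.foldl (fun R _ => g R) R).toFinset) ∧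
        ∀ x ∈ l.foldl (fun R _ => g R) R, ∀ y ∈ S, Edge A x y → y ∈ l.foldl (fun R _ => g R) R := by
    intro l
    induction l with
    | nil =>
      intro R hR hv hc hl
      have := (Finset.card_le_card (s := R.toFinset) (t := S.toFinset) fun x hx => by
        simp only [List.mem_toFinset] at hx ⊢; exact hR hx).trans S.toFinset_card_le
      simp at hl
      omega
    | cons a l ih =>
      intro R hR hv hc hl
      have hRg : R ⊆ g R := fun x hx => (mem_g R x).2 ⟨hR hx, .inl hx⟩
      have hgS : g R ⊆ S := fun x hx => ((mem_g R x).1 hx).1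
      have hcg : Conn (Edge A) (g R).toFinset := hc.extend hE (by
        intro x hx; simp at hx ⊢; exact hRg hx) fun y hy => by
          simp at hy ⊢; exact ((mem_g R y).1 hy).2
      by_cases hcl : g R ⊆ R
      · have hfix (R' : List ℕ) (h1 : R' ⊆ R) (h2 : R ⊆ R') (l : List ℕ) :
            l.foldl (fun R _ => g R) R' ⊆ R ∧ R ⊆ l.foldl (fun R _ => g R) R' := by
          induction l generalizing R' with
          | nil => exact ⟨h1, h2⟩
          | cons a l ih =>
            have e : g R' = g R := by
              refine List.filter_congr fun u _ => ?_
              rw [Bool.eq_iff_iff]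
              simp only [List.any_eq_true]
              exact ⟨fun ⟨x, hx, h⟩ => ⟨x, h1 hx, h⟩, fun ⟨x, hx, h⟩ => ⟨x, h2 hx, h⟩⟩
            exact ih (g R') (e ▸ hcl) (e ▸ hRg)
        obtain ⟨h1, h2⟩ := hfix R (List.Subset.refl _) (List.Subset.refl _) (a :: l)
        have e : ((a :: l).foldl (fun R _ => g R) R).toFinset = R.toFinset := by
          ext x; simp only [List.mem_toFinset]; exact ⟨fun h => h1 h, fun h => h2 h⟩
        refine ⟨⟨fun x hx => hR (h1 hx), h2 hv, e ▸ hc⟩, fun x hx y hy hxy => h2 (hcl ?_)⟩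
        exact (mem_g R y).2 ⟨hy, .inr ⟨x, h1 hx, hxy⟩⟩
      · refine ih (g R) hgS (hRg hv) hcg ?_
        have : R.toFinset.card < (g R).toFinset.card := Finset.card_lt_card
          ⟨fun x hx => by simp at hx ⊢; exact hRg hx, fun h => hcl fun x hx => by
            simpa using h (List.mem_toFinset.2 hx)⟩
        simp at hl
        omega
  have hS : S.length < ([v] : List ℕ).toFinset.card + S.length := by simp
  obtain ⟨⟨h1, h2, h3⟩, h4⟩ := key S [v] (by simpa using hv) (by simp)
    (by simpa using conn_singleton v) hS
  exact ⟨⟨fun x hx => by simp at hx ⊢; exact h1 hx, h3, fun x hx y hy hxy => by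
    simp at hx hy ⊢; exact h4 x hx y hy hxy⟩, h2⟩

/-- All values in the table are correct. -/
def IsExact (𝓜 : Finset (Finset ℕ)) (T : List (List ℕ × ℕ)) : Prop :=
  ∀ R j, (R, j) ∈ T → IsOpt 𝓜 R.toFinset j

lemma headD_mem {l : List ℕ} (h : l.isEmpty = false) : l.headD 0 ∈ l := by
  cases l <;> simp_all

lemma IsExact.lookup (hT : IsExact 𝓜 T) (h : (lookup T R).isEmpty = false) :
    IsOpt 𝓜 R.toFinset ((lookup T R).headD 0) := by
  obtain ⟨R', h1, h2⟩ := mem_lookup.1 (headD_mem h)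
  exact h2 ▸ hT R' _ h1

lemma isOpt_split (hE : ∀ x y, Edge A x y → Edge A y x) (h𝓜 : ∀ F ∈ 𝓜, Conn (Edge A) F)
    (hT : IsExact 𝓜 T) (h : (split A T S).1 = true) : IsOpt 𝓜 S.toFinset (split A T S).2 := by
  have key : ∀ (l : List ℕ) (s : List ℕ × Bool × ℕ), s.1.length ≤ l.length →
      (l.foldl (fun s _ => splitStep A T s) s).2.1 = true → s.2.1 = true ∧
        ∃ j, IsOpt 𝓜 s.1.toFinset j ∧ (l.foldl (fun s _ => splitStep A T s) s).2.2 = s.2.2 + j := by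
    intro l
    induction l with
    | nil =>
      intro s hs h
      have : s.1 = [] := List.length_eq_zero_iff.1 (Nat.le_zero.1 hs)
      exact ⟨h, 0, by simpa [this] using isOpt_empty h𝓜, rfl⟩
    | cons a l ih =>
      rintro ⟨R, ok, tot⟩ hs h
      rw [List.foldl_cons] at h ⊢
      cases R with
      | nil => exact ih ([], ok, tot) (Nat.zero_le _) h
      | cons v R =>
        obtain ⟨hD, hv⟩ := reach_spec hE (S := v :: R) List.mem_cons_self
        have hlt : (listDiff (v :: R) (reach A (v :: R) v)).length < (v :: R).length := by
          refine List.length_filter_lt_length_iff_exists.2 ⟨v, List.mem_cons_self, ?_⟩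
          simpa using hv
        obtain ⟨h1, j, h2, h3⟩ := ih _ (Nat.le_of_lt_succ (hlt.trans_le hs)) h
        simp only [splitStep, List.isEmpty_cons, Bool.false_eq_true, if_false, Bool.and_eq_true,
          Bool.not_eq_true', List.headD_cons] at h1 h2 h3 ⊢
        rw [toFinset_listDiff] at h2
        exact ⟨h1.1, _, (hT.lookup h1.2).add h𝓜 hD h2, by rw [h3, add_assoc]⟩
  obtain ⟨-, j, h1, h2⟩ := key S (S, true, 0) le_rfl h
  have : (split A T S).2 = j := by rw [split, h2, zero_add]
  exact this ▸ h1

/-- `split` succeeds if all components are listed in the table. -/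
lemma split_of_forall_isComp (hE : ∀ x y, Edge A x y → Edge A y x)
    (h : ∀ D : List ℕ, IsComp (Edge A) S.toFinset D.toFinset → lookup T D ≠ []) :
    (split A T S).1 = true := by
  have key : ∀ (l : List ℕ) (s : List ℕ × Bool × ℕ), s.1.toFinset ⊆ S.toFinset →
      (∀ x ∈ s.1.toFinset, ∀ y ∈ S.toFinset, Edge A x y → y ∈ s.1.toFinset) → s.2.1 = true →
      (l.foldl (fun s _ => splitStep A T s) s).2.1 = true := by
    intro l
    induction l with
    | nil => exact fun s _ _ h => h
    | cons a l ih =>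
      rintro ⟨R, ok, tot⟩ hR hcl rfl
      rw [List.foldl_cons]
      cases R with
      | nil => exact ih ([], true, tot) hR hcl rfl
      | cons v R =>
        obtain ⟨hD, hv⟩ := reach_spec hE (S := v :: R) List.mem_cons_self
        have hD' := hD.of_closed hR hcl
        refine ih _ ?_ ?_ ?_ <;>
          simp only [splitStep, List.isEmpty_cons, Bool.false_eq_true, if_false, List.headD_cons,
            toFinset_listDiff]
        · exact Finset.sdiff_subset.trans hR
        · exact fun x hx y hy hxy => hD.closed_sdiff hE x hx y
            (hcl x (Finset.sdiff_subset hx) y hy hxy) hxy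
        · simpa using h _ hD'
  exact key S (S, true, 0) subset_rfl (fun _ _ _ hy _ => hy) rfl

lemma listMax_spec {l : List ℕ} (h : l ≠ []) : listMax l ∈ l ∧ ∀ x ∈ l, x ≤ listMax l := by
  have key (l : List ℕ) (m : ℕ) :
      (l.foldl max m = m ∨ l.foldl max m ∈ l) ∧ m ≤ l.foldl max m ∧ ∀ x ∈ l, x ≤ l.foldl max m := by
    induction l generalizing m with
    | nil => simp
    | cons a l ih =>
      obtain ⟨h1, h2, h3⟩ := ih (max m a)
      simp only [List.foldl_cons, List.mem_cons]
      refine ⟨?_, by omega, ?_⟩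
      · rcases h1 with h1 | h1
        · rw [h1]; omega
        · exact .inr (.inr h1)
      · rintro x (rfl | hx)
        · omega
        · exact h3 x hx
  obtain ⟨a, l, rfl⟩ := List.exists_cons_of_ne_nil h
  obtain ⟨h1, h2, h3⟩ := key l a
  simp only [listMax, List.foldl_cons, Nat.zero_max, List.mem_cons]
  exact ⟨h1, fun x hx => hx.elim (fun h => h ▸ h2) (h3 x)⟩

/-- `𝒬` consists of all lists of at most `k` pairwise disjoint sets in `M`. -/
def IsFamilies (M : List (List ℕ)) (k : ℕ) (𝒬 : List (List (List ℕ))) : Prop :=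
  ∀ Q, Q ∈ 𝒬 ↔ Q.length ≤ k ∧ (∀ q ∈ Q, q ∈ M) ∧
    Q.Pairwise fun q q' => Disjoint q.toFinset q'.toFinset

lemma isFamilies_zero (M : List (List ℕ)) : IsFamilies M 0 [[]] := fun Q => by
  cases Q <;> simp

lemma IsFamilies.extend (h : IsFamilies M k 𝒬) : IsFamilies M (k + 1) (extend M 𝒬) := fun Q => by
  cases Q with
  | nil => simp [ListPacking.extend]
  | cons q Q =>
    simp only [ListPacking.extend, List.mem_cons, reduceCtorEq, List.mem_flatMap, List.mem_map,
      List.mem_filter, List.all_eq_true, Bool.not_eq_true', meets_eq_false_iff, false_or,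
      List.cons.injEq, List.length_cons, List.pairwise_cons, h _]
    grind

/-- Every packing with at most `k` members is listed. -/
lemma IsFamilies.exists_family_eq (h : IsFamilies M k 𝒬) {P : Finset (Finset ℕ)} {S : Finset ℕ}
    (hP : IsPacking (family M) S P) (hk : P.card ≤ k) :
    ∃ Q ∈ 𝒬, family Q = P ∧ Q.length = P.card := by
  have hM : ∀ F : Finset ℕ, ∃ q, F ∈ P → q ∈ M ∧ q.toFinset = F := fun F => by
    by_cases hF : F ∈ P
    · obtain ⟨q, hq⟩ := mem_family.1 (hP.mem F hF)
      exact ⟨q, fun _ => hq⟩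
    · exact ⟨[], fun h => (hF h).elim⟩
  choose f hf using hM
  refine ⟨P.toList.map f, (h _).2 ⟨by simpa, by simp; exact fun F hF => (hf F hF).1, ?_⟩,
    ?_, by simp⟩
  · rw [List.pairwise_map]
    refine P.nodup_toList.imp_of_mem fun {F F'} hF hF' hne => ?_
    rw [Finset.mem_toList] at hF hF'
    rw [(hf F hF).2, (hf F' hF').2]
    exact hP.disjoint F hF F' hF' hne
  · ext F
    rw [mem_family]
    simp only [List.mem_map, Finset.mem_toList]
    constructor
    · rintro ⟨_, ⟨F', hF', rfl⟩, rfl⟩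
      rwa [(hf F' hF').2]
    · exact fun hF => ⟨_, ⟨F, hF, rfl⟩, (hf F hF).2⟩

lemma IsFamilies.isPacking (h : IsFamilies M k 𝒬) (hM : ∀ F ∈ family M, F.Nonempty) (hQ : Q ∈ 𝒬)
    {S : Finset ℕ} (hS : ∀ q ∈ Q, q.toFinset ⊆ S) :
    IsPacking (family M) S (family Q) ∧ (family Q).card = Q.length := by
  obtain ⟨-, h1, h2⟩ := (h Q).1 hQ
  have hQM : ∀ q ∈ Q, q.toFinset ∈ family M := fun q hq => mem_family.2 ⟨q, h1 q hq, rfl⟩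
  have h3 : (Q.map List.toFinset).Pairwise fun F F' => Disjoint F F' := by
    rwa [List.pairwise_map]
  have h4 : (Q.map List.toFinset).Nodup := by
    rw [List.Nodup, List.pairwise_map]
    refine h2.imp_of_mem fun {q q'} hq _ hd he => ?_
    rw [← he, disjoint_self] at hd
    exact (hM _ (hQM q hq)).ne_empty hd
  refine ⟨⟨fun F hF => ?_, fun F hF => ?_, fun F hF F' hF' hne => ?_⟩, ?_⟩
  · obtain ⟨q, hq, rfl⟩ := mem_family.1 hF
    exact hQM q hq
  · obtain ⟨q, hq, rfl⟩ := mem_family.1 hF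
    exact hS q hq
  · exact h3.forall (List.mem_toFinset.1 hF) (List.mem_toFinset.1 hF') hne
  · rw [List.toFinset_card_of_nodup h4, List.length_map]

lemma isValid_iff : isValid R X Q = true ↔
    ∀ q ∈ Q, q.toFinset ⊆ R.toFinset ∧ ¬ Disjoint q.toFinset (listCover X) := by
  simp [isValid, isSubset_iff, meets_iff]

lemma isExact_nextTable (hE : ∀ x y, Edge A x y → Edge A y x) (hM : ∀ F ∈ family M, Conn (Edge A) F)
    (hcap : M.length ≤ cap) (h𝒬 : IsFamilies M k 𝒬) (h𝒰 : ∀ X ∈ 𝒰, (listCover X).card ≤ k)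
    (K : List (List ℕ)) (hT : IsExact (family M) T) :
    IsExact (family M) (nextTable A cap 𝒰 𝒬 K T) := by
  intro R j hj
  simp only [nextTable, List.mem_flatMap, List.mem_map, List.mem_filter, List.all_eq_true,
    Prod.mk.injEq] at hj
  obtain ⟨R, -, X, ⟨hX, hok⟩, rfl, rfl⟩ := hj
  have hne : ∀ F ∈ family M, F.Nonempty := fun F hF => (hM F hF).1
  have hpack : ∀ Q ∈ 𝒬, isValid R X Q = true → IsPacking (family M) R.toFinset (family Q) ∧
      (family Q).card = Q.length := fun Q hQ hv =>
    h𝒬.isPacking hne hQ fun q hq => (isValid_iff.1 hv q hq).1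
  have hopt : ∀ Q ∈ 𝒬, isValid R X Q = true →
      IsOpt (family M) (R.toFinset \ (listCover X ∪ cover (family Q)))
        (split A T (remove R X Q)).2 := fun Q hQ hv => by
    rw [← toFinset_remove]
    exact isOpt_split hE hM hT (hok Q ⟨hQ, hv⟩)
  set m := listMax ((𝒬.filter fun Q => isValid R X Q).map fun Q =>
    Q.length + (split A T (remove R X Q)).2) with hm
  have hnil : ([] : List (List ℕ)) ∈ 𝒬.filter fun Q => isValid R X Q :=
    List.mem_filter.2 ⟨(h𝒬 []).2 (by simp), rfl⟩
  obtain ⟨hmem, hmax⟩ := listMax_spec (l := (𝒬.filter fun Q => isValid R X Q).map fun Q =>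
    Q.length + (split A T (remove R X Q)).2) (by simpa using List.ne_nil_of_mem hnil)
  have hRm : IsOpt (family M) R.toFinset m := by
    refine isOpt_of_separator (X := listCover X) hM (fun P hP hPX => ?_) ?_
    · obtain ⟨Q, hQ, rfl, hlen⟩ := h𝒬.exists_family_eq hP ((hP.card_le hPX).trans (h𝒰 X hX))
      have hv : isValid R X Q = true := isValid_iff.2 fun q hq =>
        ⟨hP.subset _ (mem_family.2 ⟨q, hq, rfl⟩), hPX _ (mem_family.2 ⟨q, hq, rfl⟩)⟩
      exact ⟨_, hopt Q hQ hv, hlen ▸ hmax _ (List.mem_map.2 ⟨Q, List.mem_filter.2 ⟨hQ, hv⟩, rfl⟩)⟩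
    · obtain ⟨Q, hQ, he⟩ := List.mem_map.1 hmem
      obtain ⟨hQ, hv⟩ := List.mem_filter.1 hQ
      obtain ⟨h1, h2⟩ := hpack Q hQ hv
      exact ⟨_, _, h1, hopt Q hQ hv, by rw [h2, he]⟩
  have : min cap m = m := min_eq_right <| hRm.le_card.trans <|
    ((List.toFinset_card_le _).trans (List.length_map _).le).trans hcap
  rwa [this]

lemma isExact_table (hE : ∀ x y, Edge A x y → Edge A y x) (hM : ∀ F ∈ family M, Conn (Edge A) F)
    (hcap : M.length ≤ cap) (h𝒬 : IsFamilies M k 𝒬) (h𝒰 : ∀ X ∈ 𝒰, (listCover X).card ≤ k) :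
    IsExact (family M) (table A V cap 𝒰 𝒬 l) := by
  have key (T : List (List ℕ × ℕ)) (hT : IsExact (family M) T) : IsExact (family M)
      (l.foldl (fun T _ => nextTable A cap 𝒰 𝒬 (keys A V 𝒰 𝒬) T) T) := by
    induction l generalizing T with
    | nil => exact hT
    | cons a l ih => exact ih _ (isExact_nextTable hE hM hcap h𝒬 h𝒰 _ hT)
  exact key [] fun R j h => by simp at h

/-- If the computation succeeds, then its result is correct. -/
lemma isOpt_solve (hE : ∀ x y, Edge A x y → Edge A y x) (hM : ∀ F ∈ family M, Conn (Edge A) F)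
    (hcap : M.length ≤ cap) (h𝒬 : IsFamilies M k 𝒬) (h𝒰 : ∀ X ∈ 𝒰, (listCover X).card ≤ k)
    (h : (solve A V cap 𝒰 𝒬).1 = true) :
    IsOpt (family M) V.toFinset (solve A V cap 𝒰 𝒬).2 :=
  isOpt_split hE hM (isExact_table hE hM hcap h𝒬 h𝒰) h

/-! ### Completeness for graphs with small separators -/

/-- The neighbours in `V` of the vertices of `C` are in `C` or in `X`. -/
def BoundedBy (E : ℕ → ℕ → Prop) (V C X : Finset ℕ) : Prop :=
  ∀ x ∈ C, ∀ y ∈ V, E x y → y ∈ C ∨ y ∈ X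

/-- The property of the bags `𝓑` of a tree decomposition that the algorithm depends on: a connected
set whose neighbours lie in one bag is met by a bag that contains these neighbours too. -/
structure IsSeparatorSystem (E : ℕ → ℕ → Prop) (V : Finset ℕ) (k : ℕ) (𝓑 : Set (Finset ℕ)) :
    Prop where
  nonempty : 𝓑.Nonempty
  subset : ∀ B ∈ 𝓑, B ⊆ V
  card_le : ∀ B ∈ 𝓑, B.card ≤ k
  exists_meets : ∀ B ∈ 𝓑, ∀ C ⊆ V, Conn E C → BoundedBy E V C B →
    ∃ B' ∈ 𝓑, ¬ Disjoint B' C ∧ BoundedBy E V C B'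

section
variable {E : ℕ → ℕ → Prop} {V C X B R D : Finset ℕ} {𝓜 𝒜 P : Finset (Finset ℕ)}

/-- One step of the recursion. The state is a set `C` that is separated from the rest of the graph
by `X`, together with members `𝒜` that meet `X`, and a component `R` of `C` minus the members in
`𝒜`. If the bag `B` and members `P` that meet `B` are removed from `R`, then each component of
what remains arises in the same way from a smaller set `C'` that is separated by `B`. A member
in `𝒜` that touches `C'` must leave `C` through the neighbours of `C`, so it meets `B`. -/
lemma exists_smaller_state
    (hex : ∀ S : Finset ℕ, ∀ x ∈ S, ∃ D, IsComp E S D ∧ x ∈ D)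
    (h𝓜 : ∀ F ∈ 𝓜, Conn E F) (hCV : C ⊆ V) (hX : Disjoint C X)
    (h𝒜 : IsPacking 𝓜 V 𝒜) (h𝒜X : ∀ F ∈ 𝒜, ¬ Disjoint F X)
    (hR : IsComp E (C \ cover 𝒜) R) (hBC : ¬ Disjoint B C) (hB : BoundedBy E V C B)
    (hP : IsPacking 𝓜 R P) (hPB : ∀ F ∈ P, ¬ Disjoint F B)
    (hD : IsComp E (R \ (B ∪ cover P)) D) :
    ∃ C' 𝒜', C' ⊆ V ∧ C'.card < C.card ∧ Conn E C' ∧ Disjoint C' B ∧ BoundedBy E V C' B ∧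
      IsPacking 𝓜 V 𝒜' ∧ (∀ F ∈ 𝒜', ¬ Disjoint F B) ∧ IsComp E (C' \ cover 𝒜') D := by
  have hRC : R ⊆ C := hR.subset.trans Finset.sdiff_subset
  have hDR : D ⊆ R := hD.subset.trans Finset.sdiff_subset
  have hDB : Disjoint D B := (Finset.disjoint_union_right.1 (Finset.subset_sdiff.1 hD.subset).2).1
  have hDP : Disjoint D (cover P) :=
    (Finset.disjoint_union_right.1 (Finset.subset_sdiff.1 hD.subset).2).2
  have hD𝒜 : Disjoint D (cover 𝒜) := (Finset.subset_sdiff.1 (hDR.trans hR.subset)).2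
  have hDCB : D ⊆ C \ B := Finset.subset_sdiff.2 ⟨hDR.trans hRC, hDB⟩
  obtain ⟨x, hx⟩ := hD.conn.1
  obtain ⟨C', hC', hxC'⟩ := hex (C \ B) x (hDCB hx)
  have hC'C : C' ⊆ C := hC'.subset.trans Finset.sdiff_subset
  have hC'B : Disjoint C' B := (Finset.subset_sdiff.1 hC'.subset).2
  have hDC' : D ⊆ C' := (hD.conn.subset_or_disjoint hDCB hC'.closed).resolve_right
    fun h => Finset.disjoint_left.1 h hx hxC'
  have hPV : IsPacking 𝓜 V P := hP.mono subset_rfl fun F hF =>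
    (hP.subset F hF).trans (hRC.trans hCV)
  have hR𝒜 : Disjoint R (cover 𝒜) := (Finset.subset_sdiff.1 hR.subset).2
  have hd : ∀ F ∈ 𝒜, ∀ F' ∈ P, Disjoint F F' := fun F hF F' hF' =>
    ((disjoint_cover.1 hR𝒜 F hF).mono_left (hP.subset F' hF')).symm
  refine ⟨C', (𝒜 ∪ P).filter fun F => ¬ Disjoint F B, hC'C.trans hCV, ?_, hC'.conn, hC'B, ?_,
    (h𝒜.union hPV hd).mono (Finset.filter_subset _ _) fun F hF => ?_,
    fun F hF => (Finset.mem_filter.1 hF).2, ?_, hD.conn, ?_⟩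
  · obtain ⟨y, hyB, hyC⟩ := Finset.not_disjoint_iff.1 hBC
    exact Finset.card_lt_card ⟨hC'C, fun h => Finset.disjoint_left.1 hC'B (h hyC) hyB⟩
  · intro y hy z hz hyz
    by_cases hzB : z ∈ B
    · exact .inr hzB
    · exact .inl (hC'.closed y hy z (Finset.mem_sdiff.2
        ⟨(hB y (hC'C hy) z hz hyz).resolve_right hzB, hzB⟩) hyz)
  · exact (h𝒜.union hPV hd).subset F (Finset.filter_subset _ _ hF)
  · refine Finset.subset_sdiff.2 ⟨hDC', disjoint_cover.2 fun F hF => ?_⟩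
    rcases Finset.mem_union.1 (Finset.mem_filter.1 hF).1 with hF | hF
    · exact disjoint_cover.1 hD𝒜 F hF
    · exact disjoint_cover.1 hDP F hF
  · intro y hy z hz hyz
    obtain ⟨hzC', hz𝒜⟩ := Finset.mem_sdiff.1 hz
    have hzC : z ∈ C := hC'C hzC'
    have hzB : z ∉ B := fun h => Finset.disjoint_left.1 hC'B hzC' h
    have key : ∀ F ∈ 𝒜 ∪ P, ¬ Disjoint F B → z ∉ F := fun F hF hFB hzF =>
      hz𝒜 (Finset.mem_sup.2 ⟨F, Finset.mem_filter.2 ⟨hF, hFB⟩, hzF⟩)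
    have hzA : z ∉ cover 𝒜 := by
      intro h
      obtain ⟨F, hF, hzF⟩ := Finset.mem_sup.1 h
      refine key F (Finset.mem_union_left _ hF) (fun hFB => ?_) hzF
      have hFC := ((h𝓜 F (h𝒜.mem F hF)).subset_or_disjoint (D := F ∩ C) subset_rfl
        fun u hu w hw huw => ?_).resolve_right fun h => Finset.disjoint_left.1 h hzF
          (Finset.mem_inter.2 ⟨hzF, hzC⟩)
      · exact h𝒜X F hF (hX.mono_left (hFC.trans Finset.inter_subset_right))
      · refine Finset.mem_inter.2 ⟨hw, (hB u (Finset.mem_inter.1 hu).2 w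
          (h𝒜.subset F hF hw) huw).resolve_right fun h => Finset.disjoint_left.1 hFB hw h⟩
    have hzP : z ∉ cover P := by
      intro h
      obtain ⟨F, hF, hzF⟩ := Finset.mem_sup.1 h
      exact key F (Finset.mem_union_right _ hF) (hPB F hF) hzF
    have hzR := hR.closed y (hDR hy) z (Finset.mem_sdiff.2 ⟨hzC, hzA⟩) hyz
    refine hD.closed y hy z (Finset.mem_sdiff.2 ⟨hzR, fun h => ?_⟩) hyz
    exact (Finset.mem_union.1 h).elim hzB hzP

/-- The component `R` of a state is a component of the graph without `X` and `𝒜`. -/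
lemma isComp_of_state (hCV : C ⊆ V) (hX : Disjoint C X) (hB : BoundedBy E V C X)
    (hR : IsComp E (C \ cover 𝒜) R) : IsComp E (V \ (X ∪ cover 𝒜)) R := by
  obtain ⟨h1, h2⟩ := Finset.subset_sdiff.1 hR.subset
  refine ⟨Finset.subset_sdiff.2 ⟨h1.trans hCV, Finset.disjoint_union_right.2
    ⟨hX.mono_left h1, h2⟩⟩, hR.conn, fun x hx y hy hxy => ?_⟩
  rw [Finset.mem_sdiff, Finset.mem_union, not_or] at hy
  exact hR.closed x hx y (Finset.mem_sdiff.2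
    ⟨(hB x (h1 hx) y hy.1 hxy).resolve_right hy.2.1, hy.2.2⟩) hxy

end

variable {A : List (List Bool)} {V : List ℕ} {M : List (List ℕ)}
  {𝒰 𝒬 : List (List (List ℕ))} {cap k : ℕ} {𝓑 : Set (Finset ℕ)}

lemma exists_isComp (hE : ∀ x y, Edge A x y → Edge A y x) (S : Finset ℕ) (x : ℕ) (hx : x ∈ S) :
    ∃ D, IsComp (Edge A) S D ∧ x ∈ D := by
  obtain ⟨h1, h2⟩ := reach_spec hE (S := S.toList) (v := x) (by simpa using hx)
  exact ⟨_, by simpa using h1, by simpa using h2⟩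

/-- The sets with at most `k` elements are the unions of the families in `𝒰`. -/
structure IsSeparators (V : List ℕ) (k : ℕ) (𝒰 : List (List (List ℕ))) : Prop where
  card_le : ∀ X ∈ 𝒰, (listCover X).card ≤ k
  exists_eq : ∀ B ⊆ V.toFinset, B.card ≤ k → ∃ X ∈ 𝒰, listCover X = B

lemma IsFamilies.isSeparators (h : IsFamilies (V.map fun v => [v]) k 𝒰) : IsSeparators V k 𝒰 := by
  refine ⟨fun X hX => ?_, fun B hB hk => ?_⟩
  · obtain ⟨h1, h2, -⟩ := (h X).1 hX
    refine (List.toFinset_card_le _).trans ?_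
    rw [List.length_flatten]
    refine (List.sum_le_card_nsmul _ 1 fun m hm => ?_).trans (by simpa using h1)
    obtain ⟨q, hq, rfl⟩ := List.mem_map.1 hm
    obtain ⟨v, -, rfl⟩ := List.mem_map.1 (h2 q hq)
    simp
  · refine ⟨B.toList.map fun v => [v], (h _).2 ⟨by simpa, ?_, ?_⟩, ?_⟩
    · intro q hq
      simp only [List.mem_map, Finset.mem_toList] at hq ⊢
      obtain ⟨v, hv, rfl⟩ := hq
      exact ⟨v, List.mem_toFinset.1 (hB hv), rfl⟩
    · rw [List.pairwise_map]
      exact B.nodup_toList.imp fun h => by simpa using h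
    · ext; simp

/-- After `l.length` rounds, the table contains all states with `|C| ≤ l.length`. -/
lemma lookup_table_ne_nil (hE : ∀ x y, Edge A x y → Edge A y x)
    (hM : ∀ F ∈ family M, Conn (Edge A) F) (h𝒬 : IsFamilies M k 𝒬) (h𝒰 : IsSeparators V k 𝒰)
    (h𝓑 : IsSeparatorSystem (Edge A) V.toFinset k 𝓑) :
    ∀ (c : ℕ) (C : Finset ℕ), C.card = c → ∀ (l : List ℕ), C.card ≤ l.length →
    ∀ (X B₀ : Finset ℕ) (𝒜 : Finset (Finset ℕ)) (R : List ℕ), C ⊆ V.toFinset → Conn (Edge A) C →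
      X ⊆ V.toFinset → X.card ≤ k → Disjoint C X → BoundedBy (Edge A) V.toFinset C X →
      B₀ ∈ 𝓑 → BoundedBy (Edge A) V.toFinset C B₀ →
      IsPacking (family M) V.toFinset 𝒜 → (∀ F ∈ 𝒜, ¬ Disjoint F X) →
      IsComp (Edge A) (C \ cover 𝒜) R.toFinset → lookup (table A V cap 𝒰 𝒬 l) R ≠ [] := by
  intro c
  induction c using Nat.strong_induction_on with
  | _ c ih =>
  rintro C rfl l hl X B₀ 𝒜 R hCV hC hXV hXk hCX hCb hB₀ hCB₀ h𝒜 h𝒜X hR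
  obtain ⟨B, hB𝓑, hBC, hCB⟩ := h𝓑.exists_meets B₀ hB₀ C hCV hC hCB₀
  -- the components that the removal of `B` and of members meeting `B` leaves
  have step : ∀ (l' : List ℕ) (P : Finset (Finset ℕ)) (D : List ℕ), C.card ≤ l'.length + 1 →
      IsPacking (family M) R.toFinset P → (∀ F ∈ P, ¬ Disjoint F B) →
      IsComp (Edge A) (R.toFinset \ (B ∪ cover P)) D.toFinset →
      lookup (table A V cap 𝒰 𝒬 l') D ≠ [] := by
    intro l' P D hl' hP hPB hD
    obtain ⟨C', 𝒜', h1, h2, h3, h4, h5, h6, h7, h8⟩ := exists_smaller_state (exists_isComp hE) hM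
      hCV hCX h𝒜 h𝒜X hR hBC hCB hP hPB hD
    exact ih C'.card h2 C' rfl l' (by omega) B B 𝒜' D h1 h3 (h𝓑.subset B hB𝓑)
      (h𝓑.card_le B hB𝓑) h4 h5 hB𝓑 h5 h6 h7 h8
  obtain ⟨l', a, rfl⟩ : ∃ l' a, l = l' ++ [a] := by
    rcases l.eq_nil_or_concat' with rfl | ⟨l', a, rfl⟩
    · exact absurd (Finset.card_pos.2 hC.1) (by simpa using hl)
    · exact ⟨l', a, rfl⟩
  obtain ⟨XB, hXB, hXBe⟩ := h𝒰.exists_eq B (h𝓑.subset B hB𝓑) (h𝓑.card_le B hB𝓑)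
  obtain ⟨X', hX', rfl⟩ := h𝒰.exists_eq X hXV hXk
  obtain ⟨Q', hQ', rfl, -⟩ := h𝒬.exists_family_eq h𝒜 ((h𝒜.card_le h𝒜X).trans hXk)
  -- `R` is one of the sets for which values are computed
  obtain ⟨x, hx⟩ := hR.conn.1
  have hR' := isComp_of_state hCV hCX hCb hR
  rw [← toFinset_remove] at hR'
  obtain ⟨h1, h2⟩ := reach_spec hE (List.mem_toFinset.1 (hR'.subset hx))
  have heq : (reach A (remove V X' Q') x).toFinset = R.toFinset :=
    h1.eq_of_mem hR' (List.mem_toFinset.2 h2) hx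
  have hkey : reach A (remove V X' Q') x ∈ keys A V 𝒰 𝒬 :=
    List.mem_flatMap.2 ⟨X', hX', List.mem_flatMap.2 ⟨Q', hQ', List.mem_map.2
      ⟨x, List.mem_toFinset.1 (hR'.subset hx), rfl⟩⟩⟩
  set R₀ := reach A (remove V X' Q') x
  suffices h : ∃ j, (R₀, j) ∈ table A V cap 𝒰 𝒬 (l' ++ [a]) by
    obtain ⟨j, hj⟩ := h
    exact List.ne_nil_of_mem (mem_lookup.2 ⟨R₀, hj, heq⟩)
  simp only [table, List.foldl_append, List.foldl_cons, List.foldl_nil]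
  simp only [nextTable, List.mem_flatMap, List.mem_map, List.mem_filter, List.all_eq_true]
  refine ⟨_, R₀, hkey, XB, ⟨hXB, fun Q hQ => ?_⟩, rfl⟩
  have hv := isValid_iff.1 hQ.2
  rw [heq, hXBe] at hv
  refine split_of_forall_isComp hE fun D hD => ?_
  rw [toFinset_remove, heq, hXBe] at hD
  refine step l' (family Q) D (by simpa using hl) ?_ (fun F hF => ?_) hD
  · exact (h𝒬.isPacking (fun F hF => (hM F hF).1) hQ.1 fun q hq => (hv q hq).1).1
  · obtain ⟨q, hq, rfl⟩ := mem_family.1 hF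
    exact (hv q hq).2

/-- The computation succeeds if the graph has a separator system. -/
lemma solve_of_isSeparatorSystem (hE : ∀ x y, Edge A x y → Edge A y x)
    (hM : ∀ F ∈ family M, Conn (Edge A) F) (h𝒬 : IsFamilies M k 𝒬) (h𝒰 : IsSeparators V k 𝒰)
    (h𝓑 : IsSeparatorSystem (Edge A) V.toFinset k 𝓑) : (solve A V cap 𝒰 𝒬).1 = true := by
  refine split_of_forall_isComp hE fun D hD => ?_
  obtain ⟨B, hB⟩ := h𝓑.nonempty
  have hDV : D.toFinset.card ≤ V.length :=
    (Finset.card_le_card hD.subset).trans (List.toFinset_card_le _)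
  exact lookup_table_ne_nil hE hM h𝒬 h𝒰 h𝓑 _ D.toFinset rfl V hDV ∅ B ∅ D hD.subset hD.conn
    (by simp) (by simp) (by simp) (fun x hx y hy hxy => .inl (hD.closed x hx y hy hxy)) hB
    (fun x hx y hy hxy => .inl (hD.closed x hx y hy hxy)) ⟨by simp, by simp, by simp⟩ (by simp)
    (by simpa using hD.conn.isComp_self)

/-! ### Tree decompositions yield separator systems -/

section Tree
open SimpleGraph
variable {ι : Type*} {T : SimpleGraph ι}

lemma exists_walk_of_induce_connected {W : Set ι} (h : (T.induce W).Connected) {i j : ι}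
    (hi : i ∈ W) (hj : j ∈ W) : ∃ p : T.Walk i j, ∀ x ∈ p.support, x ∈ W := by
  obtain ⟨p⟩ := h.preconnected ⟨i, hi⟩ ⟨j, hj⟩
  refine ⟨p.map (Embedding.induce W).toHom, fun x hx => ?_⟩
  obtain ⟨y, -, rfl⟩ := List.mem_map.1 ((Walk.support_map _ p) ▸ hx)
  exact y.2

/-- The vertex `t` of a connected set `W` that is closest to `s` lies on every walk from `s` to a
vertex of `W`. -/
lemma mem_of_walk_of_closest (hT : T.IsTree) {W U : Set ι} {s t y : ι} (ht : t ∈ W)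
    (hmin : ∀ x ∈ W, T.dist s t ≤ T.dist s x) (q : T.Walk t y) (hq : ∀ x ∈ q.support, x ∈ W)
    (r : T.Walk s y) (hr : ∀ x ∈ r.support, x ∈ U) : t ∈ U := by
  classical
  obtain ⟨p, hp, hpl⟩ := hT.connected.exists_path_of_dist s t
  have hpW : ∀ x ∈ p.support, x ∈ W → x = t := fun x hx hxW => by
    by_contra hne
    have h1 := dist_le (p.takeUntil x hx)
    have h2 := p.length_takeUntil_lt_length hx hne
    have h3 := hmin x hxW
    omega
  have hpath : (p.append q.bypass).IsPath := by
    rw [Walk.isPath_def, Walk.support_append, List.nodup_append']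
    have hn := q.bypass_isPath.support_nodup
    rw [← Walk.cons_tail_support, List.nodup_cons] at hn
    refine ⟨hp.support_nodup, hn.2, fun x hx hx' => hn.1 ?_⟩
    have : x ∈ W := hq x (q.support_bypass_subset_support (List.mem_of_mem_tail hx'))
    exact hpW x hx this ▸ hx'
  have := (hT.isAcyclic.subsingleton_path s y).elim ⟨_, hpath⟩ ⟨_, r.bypass_isPath⟩
  refine hr t (r.support_bypass_subset_support ?_)
  rw [← congrArg (fun p : T.Path s y => p.1.support) this]
  simp

end Tree

section Bags
variable {n : ℕ} {G : SimpleGraph (Fin n)} {E : ℕ → ℕ → Prop}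

/-- The bags of a tree decomposition form a separator system. If the neighbours of `C` lie in the
bag at `s`, then they also lie in the bag at `t`, the node closest to `s` whose bag meets `C`: for a
neighbour `v` of `u ∈ C`, the nodes whose bags contain `v` include `s` and a node whose bag contains
`u`, so they include `t`. -/
lemma TreeDecomposition.isSeparatorSystem (D : TreeDecomposition G)
    (hE : ∀ u v : Fin n, E u v ↔ G.Adj u v) :
    IsSeparatorSystem E (Finset.range n) (D.width + 1)
      (Set.range fun i => (D.bag i).map Fin.valEmbedding) where
  nonempty := by
    obtain ⟨i⟩ := D.isTree.connected.nonempty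
    exact ⟨_, i, rfl⟩
  subset := by
    rintro _ ⟨i, rfl⟩ x hx
    obtain ⟨v, -, rfl⟩ := Finset.mem_map.1 hx
    simp
  card_le := by
    rintro _ ⟨i, rfl⟩
    have := Finset.le_sup (f := fun i => (D.bag i).card) (Finset.mem_univ i)
    simp only [Finset.card_map, TreeDecomposition.width] at this ⊢
    omega
  exists_meets := by
    rintro _ ⟨s, rfl⟩ C hCV hC hCs
    have mem_bag (v : Fin n) (i) : (v : ℕ) ∈ (D.bag i).map Fin.valEmbedding ↔ v ∈ D.bag i := by
      simp [Fin.val_inj]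
    have lift : ∀ x ∈ C, ∃ v : Fin n, (v : ℕ) = x := fun x hx =>
      ⟨⟨x, by simpa using hCV hx⟩, rfl⟩
    -- the nodes whose bags meet `C`
    let W : Set (Fin D.m) := {i | ∃ v ∈ D.bag i, (v : ℕ) ∈ C}
    have hW : ∀ i ∈ W, ∀ j ∈ W, ∃ p : D.tree.Walk i j, ∀ x ∈ p.support, x ∈ W := by
      classical
      rintro i ⟨v₀, hi, hv₀⟩
      -- the vertices of `C` whose nodes can be reached from `i`
      let C' := C.filter fun x => ∀ v : Fin n, (v : ℕ) = x → ∀ j, v ∈ D.bag j →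
        ∃ p : D.tree.Walk i j, ∀ x ∈ p.support, x ∈ W
      have hwalk (v : Fin n) (hv : (v : ℕ) ∈ C) (j k) (hj : v ∈ D.bag j) (hk : v ∈ D.bag k) :
          ∃ p : D.tree.Walk j k, ∀ x ∈ p.support, x ∈ W := by
        obtain ⟨p, hp⟩ := exists_walk_of_induce_connected (D.subtree v) hj hk
        exact ⟨p, fun x hx => ⟨v, hp x hx, hv⟩⟩
      have hC' : C' = C := by
        refine hC.2 C' (Finset.filter_subset _ _)
          ⟨v₀, Finset.mem_filter.2 ⟨hv₀, fun v hv j hj => ?_⟩⟩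
          fun x hx y hy hxy => Finset.mem_filter.2 ⟨hy, ?_⟩
        · obtain rfl := Fin.val_injective hv
          exact hwalk v hv₀ i j hi hj
        · obtain ⟨u, rfl⟩ := lift x (Finset.filter_subset _ _ hx)
          rintro v rfl j hj
          obtain ⟨k, hk, hk'⟩ := D.edge_mem u v ((hE u v).1 hxy)
          obtain ⟨p, hp⟩ := (Finset.mem_filter.1 hx).2 u rfl k hk
          obtain ⟨q, hq⟩ := hwalk v hy k j hk' hj
          refine ⟨p.append q, fun x hx => ?_⟩
          exact (SimpleGraph.Walk.mem_support_append_iff _ _).1 hx |>.elim (hp x) (hq x)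
      rintro j ⟨v, hj, hv⟩
      have hv' : (v : ℕ) ∈ C' := hC'.symm ▸ hv
      exact (Finset.mem_filter.1 hv').2 v rfl j hj
    have hne : W.Nonempty := by
      obtain ⟨x, hx⟩ := hC.1
      obtain ⟨v, rfl⟩ := lift x hx
      obtain ⟨i, hi⟩ := D.vertex_mem v
      exact ⟨i, v, hi, hx⟩
    obtain ⟨t, ht, hmin⟩ := W.toFinite.exists_minimalFor (D.tree.dist s) W hne
    have hmin' : ∀ x ∈ W, D.tree.dist s t ≤ D.tree.dist s x := fun x hx => by
      by_contra h
      exact h (hmin hx (not_le.1 h).le)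
    refine ⟨_, ⟨t, rfl⟩, ?_, fun x hx y hy hxy => ?_⟩
    · obtain ⟨v, hv, hvC⟩ := ht
      exact Finset.not_disjoint_iff.2 ⟨v, (mem_bag v t).2 hv, hvC⟩
    · obtain ⟨u, rfl⟩ := lift x hx
      obtain ⟨v, rfl⟩ : ∃ v : Fin n, (v : ℕ) = y := ⟨⟨y, by simpa using hy⟩, rfl⟩
      refine or_iff_not_imp_left.2 fun hvC => (mem_bag v t).2 ?_
      have hvs := (mem_bag v s).1 ((hCs u hx v hy hxy).resolve_left hvC)
      obtain ⟨j, hj, hj'⟩ := D.edge_mem u v ((hE u v).1 hxy)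
      obtain ⟨q, hq⟩ := hW t ht j ⟨u, hj, hx⟩
      obtain ⟨r, hr⟩ := exists_walk_of_induce_connected (D.subtree v) hvs hj'
      exact mem_of_walk_of_closest D.isTree ht hmin' q hq r hr

end Bags

section Treewidth
variable {n : ℕ} (G : SimpleGraph (Fin n))

lemma exists_treeDecomposition_width_le :
    ∃ D : TreeDecomposition G, D.width ≤ n - 1 := by
  refine ⟨⟨1, ⊤, ?_, fun _ => Finset.univ, fun v => ⟨0, by simp⟩, fun u v _ => ⟨0, by simp⟩,
    fun v => ?_⟩, ?_⟩
  · exact SimpleGraph.IsTree.of_subsingleton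
  · have : Nonempty ({i | v ∈ (fun _ : Fin 1 => (Finset.univ : Finset (Fin n))) i} : Set (Fin 1)) :=
      ⟨0, by simp⟩
    exact (SimpleGraph.IsTree.of_subsingleton).connected
  · simp [TreeDecomposition.width]

lemma exists_treeDecomposition : ∃ D : TreeDecomposition G, D.width = treewidth G := by
  obtain ⟨D, -⟩ := exists_treeDecomposition_width_le G
  exact Nat.sInf_mem (s := {w | ∃ D : TreeDecomposition G, D.width = w}) ⟨D.width, D, rfl⟩

lemma treewidth_le : treewidth G ≤ n - 1 := by
  obtain ⟨D, hD⟩ := exists_treeDecomposition_width_le G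
  exact (Nat.sInf_le (s := {w | ∃ D : TreeDecomposition G, D.width = w}) ⟨D, rfl⟩).trans hD

end Treewidth

/-! ### The complete program -/

/-- The lists of numbers below the length of a list, in decreasing order. -/
def indices {β : Type} (l : List β) : List ℕ := l.foldl (fun acc _ => acc.length :: acc) []

lemma indices_eq {β : Type} (l : List β) : indices l = (List.range l.length).reverse := by
  have key (l : List β) (m : ℕ) : l.foldl (fun acc _ => acc.length :: acc) (List.range m).reverse =
      (List.range (m + l.length)).reverse := by
    induction l generalizing m with
    | nil => rfl
    | cons a l ih =>
      rw [List.foldl_cons, List.length_reverse, List.length_range, List.length_cons,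
        Nat.add_comm l.length, ← Nat.add_assoc, ← ih, List.range_succ, List.reverse_append]
      rfl
  simpa [indices] using key l 0

/-- The value of a list of binary digits with the most significant digit first, cut off at
`cap`. -/
def cappedValue (cap : ℕ) (bits : List Bool) : ℕ :=
  bits.foldl (fun x b => min cap (x + x + if b then 1 else 0)) 0

/-- The data of an instance, as encoded: the adjacency matrix, the subgraphs, the binary digits of
`k`. -/
abbrev RawInput : Type := List (List Bool) × List (List Bool × List (List Bool)) × List Bool

/-- One step of `readBits`. -/
def readStep (s : List Bool × List Bool) : List Bool × List Bool :=
  (s.1.tail, s.1.headD false :: s.2)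

/-- The state of `readBits` after all steps. -/
def readLoop (a : RawInput) : List Bool × List Bool :=
  (([], []) :: a.2.1).foldl (fun s _ => readStep s) (a.2.2, [])

/-- The first `|L| + 1` digits of `k` in reversed order, and whether these are all digits. The
number `k` is larger than `|L|` if there are more, and the time must not depend on how many there
are. -/
def readBits (a : RawInput) : (List (List Bool) × List (List Bool × List (List Bool))) ×
    List Bool × Bool :=
  ((a.1, a.2.1), (readLoop a).2, (readLoop a).1.isEmpty)

/-- The data for `search`: the adjacency matrix, the vertices, the members as vertex sets, `k` (cut
off at a number larger than the number of members), and whether an answer `true` is possible. -/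
abbrev SearchInput : Type := List (List Bool) × List ℕ × List (List ℕ) × ℕ × Bool

/-- The preprocessing. -/
def prepare (a : (List (List Bool) × List (List Bool × List (List Bool))) × List Bool × Bool) :
    SearchInput :=
  (a.1.1, indices a.1.1, a.1.2.map fun F => (indices a.1.1).filter fun v => F.1.getD v false,
    cappedValue (a.1.2.length + 1) a.2.1, a.2.2)

/-- The state of `search`: whether the answer is known, the answer, and the lists of separators and
of families of members for the current width. -/
abbrev SearchState : Type := Bool × Bool × List (List (List ℕ)) × List (List (List ℕ))

/-- The width is increased by one. -/
def widen (y : SearchInput) (s : SearchState) : SearchState :=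
  ((solve y.1 y.2.1 y.2.2.1.length (extend (y.2.1.map fun v => [v]) s.2.2.1)
      (extend y.2.2.1 s.2.2.2)).1,
    y.2.2.2.2 && decide (y.2.2.2.1 ≤ (solve y.1 y.2.1 y.2.2.1.length
      (extend (y.2.1.map fun v => [v]) s.2.2.1) (extend y.2.2.1 s.2.2.2)).2),
    extend (y.2.1.map fun v => [v]) s.2.2.1, extend y.2.2.1 s.2.2.2)

/-- One step of `search`. -/
def searchStep (y : SearchInput) (s : SearchState) : SearchState :=
  if s.1 then s else widen y s

/-- The state of `search` after the steps in `l`. -/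
def searchLoop (y : SearchInput) (l : List ℕ) : SearchState :=
  l.foldl (fun s _ => searchStep y s) (false, false, [[]], [[]])

/-- The computation is tried with increasing width until it succeeds. -/
def search (y : SearchInput) : Bool := (searchLoop y (0 :: y.2.1)).2.1

section
variable {α β : Type} [Code α] [Code β]

@[fun_prop]
lemma PolyTime.indices {l : α → List β} (hl : PolyTime l) : PolyTime fun a => indices (l a) := by
  refine foldl (s := fun _ acc _ => acc.length :: acc) (by fun_prop) hl (by fun_prop)
    (B := fun a => sz (l a) * (2 * sz (l a) + 2) + 2)
    ((hl.2.mul (((PolyBdd.sz_const 2).mul hl.2).add two_le_sz (.sz_const 2))).add two_le_sz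
      (.sz_const 2)) fun a l' hl' => ?_
  have h1 : l'.length ≤ sz (l a) := hl'.length_le.trans (by have := length_le_sz (l a); omega)
  refine (sz_le_of_forall (B := 2 * sz (l a) + 2) fun v hv => ?_).trans ?_
  · have : v ∈ ListPacking.indices l' := hv
    rw [indices_eq, List.mem_reverse, List.mem_range] at this
    rw [sz_nat]
    omega
  · have : (l'.foldl (fun acc _ => acc.length :: acc) []).length = l'.length := by
      change (ListPacking.indices l').length = _
      rw [indices_eq, List.length_reverse, List.length_range]
    rw [this]
    gcongr

@[fun_prop]
lemma PolyTime.cappedValue {c : α → ℕ} {l : α → List Bool} (hc : PolyTime c) (hl : PolyTime l) :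
    PolyTime fun a => cappedValue (c a) (l a) := by
  unfold ListPacking.cappedValue
  refine foldl (s := fun a x b => Min.min (c a) (x + x + if b then 1 else 0))
    (b := fun _ => 0) (by fun_prop) hl (by fun_prop) (hc.2.add two_le_sz (.sz_const 2))
    fun a l' _ => ?_
  rcases l'.eq_nil_or_concat' with rfl | ⟨l, x, rfl⟩
  · simp
  · rw [List.foldl_append, List.foldl_cons, List.foldl_nil, sz_nat, sz_nat]
    omega

lemma polyTime_prepare : PolyTime prepare := by
  unfold prepare; fun_prop

lemma polyTime_widen : PolyTime fun q : SearchInput × SearchState × ℕ => widen q.1 q.2.1 := by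
  unfold widen; fun_prop

/-- Reading the digits takes time linear in the number of members. -/
lemma computesIn_readBits : ∃ C, ComputesIn readBits fun a => C * (a.2.1.length + 1) := by
  have hs : ComputesIn (fun q : RawInput × (List Bool × List Bool) ×
      (List Bool × List (List Bool)) => readStep q.2.1) fun _ => 20 + 1 :=
    .of_exp (fun d => .cons (.tl (.hd (.hd (.tl (.var d)))))
      (.cons (.hd (.hd (.hd (.tl (.var d))))) (.tl (.hd (.tl (.var d)))))) 20
      (fun _ => by simp [Exp.cost]) fun d σ q h => by
        obtain ⟨a, ⟨l, r⟩, x⟩ := q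
        cases l <;> simp [Exp.eval, h, Dat.hd, Dat.tl, readStep]
  have hb : ComputesIn (fun a : RawInput => (a.2.2, ([] : List Bool))) fun _ => 10 + 1 :=
    .of_exp (fun d => .cons (.tl (.tl (.var d))) .nil) 10 (fun _ => by simp [Exp.cost])
      fun d σ a h => by simp [Exp.eval, h, Dat.tl]
  have hl : ComputesIn (fun a : RawInput => (([], []) : List Bool × List (List Bool)) :: a.2.1)
      fun _ => 10 + 1 :=
    .of_exp (fun d => .cons (.cons .nil .nil) (.hd (.tl (.var d)))) 10 (fun _ => by simp [Exp.cost])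
      fun d σ a h => by simp [Exp.eval, h, Dat.tl, Dat.hd]
  have hloop : ComputesIn readLoop _ :=
    hs.foldl (s := fun _ s _ => readStep s) hb hl (B := fun _ => 21) fun _ _ _ _ _ => le_rfl
  have h1 : ComputesIn (fun s : List Bool × List Bool => s.2) fun _ => 2 + 1 :=
    .of_exp (fun d => .tl (.var d)) 2 (fun _ => le_rfl) fun d σ a h => by simp [Exp.eval, h, Dat.tl]
  have h2 : ComputesIn (fun s : List Bool × List Bool => s.1) fun _ => 2 + 1 :=
    .of_exp (fun d => .hd (.var d)) 2 (fun _ => le_rfl) fun d σ a h => by simp [Exp.eval, h, Dat.hd]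
  have h3 : ComputesIn (fun a : RawInput => (a.1, a.2.1)) fun _ => 10 + 1 :=
    .of_exp (fun d => .cons (.hd (.var d)) (.hd (.tl (.var d)))) 10 (fun _ => by simp [Exp.cost])
      fun d σ a h => by simp [Exp.eval, h, Dat.tl, Dat.hd]
  refine ⟨200, (h3.pair ((h1.pair (ComputesIn.isEmpty.comp h2)).comp hloop)).mono fun a => ?_⟩
  simp only [List.length_cons]
  omega

/-- The time of `search`: the time that one step takes depends on the state only until the answer is
known. -/
lemma computesIn_search : ∃ c T, ComputesIn search T ∧ ∀ (y : SearchInput) (B : ℕ),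
    (∀ l, l <+: 0 :: y.2.1 → (searchLoop y l).1 = false → sz (searchLoop y l) ≤ B) →
    T y ≤ (sz y + B) ^ c := by
  obtain ⟨⟨T, hT, c, hc⟩, -⟩ := polyTime_widen
  have hdone : ComputesIn (fun q : SearchInput × SearchState × ℕ => q.2.1.1) fun _ => 10 + 1 :=
    .of_exp (fun d => .hd (.hd (.tl (.var d)))) 10 (fun _ => by simp [Exp.cost])
      fun d σ a h => by simp [Exp.eval, h, Dat.tl, Dat.hd]
  have hkeep : ComputesIn (fun q : SearchInput × SearchState × ℕ => q.2.1) fun _ => 10 + 1 :=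
    .of_exp (fun d => .hd (.tl (.var d))) 10 (fun _ => by simp [Exp.cost])
      fun d σ a h => by simp [Exp.eval, h, Dat.tl, Dat.hd]
  have hstep : ComputesIn (fun q : SearchInput × SearchState × ℕ => searchStep q.1 q.2.1) _ :=
    hdone.ite hkeep hT
  have hinit : ComputesIn
      (fun _ : SearchInput => ((false, false, [[]], [[]]) : SearchState)) fun _ => 15 + 1 :=
    .of_exp (fun _ => .cons .nil (.cons .nil (.cons (.cons .nil .nil) (.cons .nil .nil)))) 15
      (fun _ => by simp [Exp.cost]) fun _ _ _ _ => by simp [Exp.eval]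
  have hl : ComputesIn (fun y : SearchInput => 0 :: y.2.1) fun _ => 10 + 1 :=
    .of_exp (fun d => .cons .nil (.hd (.tl (.var d)))) 10 (fun _ => by simp [Exp.cost])
      fun d σ a h => by simp [Exp.eval, h, Dat.tl, Dat.hd]
  -- the maximum time of a step
  let m : SearchInput → ℕ := fun y => (Finset.range (y.2.1.length + 1)).sup fun j =>
    if (searchLoop y ((0 :: y.2.1).take j)).1 then 0 else
      T (y, searchLoop y ((0 :: y.2.1).take j), (0 :: y.2.1).getD j 0)
  have hloop : ComputesIn (fun y => searchLoop y (0 :: y.2.1)) _ :=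
    hstep.foldl (s := fun y s _ => searchStep y s) hinit hl (B := fun y => m y + 30)
      fun y l₁ x l₂ h => by
        have hj : l₁.length ∈ Finset.range (y.2.1.length + 1) := by
          have := congrArg List.length h
          simp only [List.length_cons, List.length_append] at this
          rw [Finset.mem_range]
          omega
        have hle := Finset.le_sup (f := fun j =>
          if (searchLoop y ((0 :: y.2.1).take j)).1 then 0 else
            T (y, searchLoop y ((0 :: y.2.1).take j), (0 :: y.2.1).getD j 0)) hj
        have h1 : (0 :: y.2.1).take l₁.length = l₁ := by rw [h]; simp
        have h2 : (0 :: y.2.1).getD l₁.length 0 = x := by rw [h]; simp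
        simp only [h1, h2] at hle
        change _ ≤ m y at hle
        change 10 + 1 + (if (searchLoop y l₁).1 = true then 10 + 1 else T (y, searchLoop y l₁, x)) +
          4 ≤ m y + 30
        split_ifs at hle ⊢ <;> omega
  have hans : ComputesIn (fun s : SearchState => s.2.1) fun _ => 10 + 1 :=
    .of_exp (fun d => .hd (.tl (.var d))) 10 (fun _ => by simp [Exp.cost])
      fun d σ a h => by simp [Exp.eval, h, Dat.tl, Dat.hd]
  refine ⟨2 * c + 8, _, hans.comp hloop, fun y B hB => ?_⟩
  have hm : m y ≤ (sz y + B + sz y) ^ c := by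
    refine Finset.sup_le fun j hj => ?_
    split_ifs with hd
    · exact Nat.zero_le _
    · refine (hc _).trans (Nat.pow_le_pow_left ?_ c)
      have h1 := hB _ (List.take_prefix j _) (by simpa using hd)
      have h2 : sz ((0 :: y.2.1).getD j 0) ≤ sz y := by
        rw [List.getD_eq_getElem _ _ (by simpa using hj)]
        refine (sz_le_of_mem (List.getElem_mem _)).trans ?_
        have := two_le_sz y.1
        simp only [sz_cons, sz_prod, sz_nat]
        omega
      simp only [sz_prod] at h1 h2 ⊢
      omega
  have hx : 2 ≤ sz y + B := (two_le_sz y).trans (Nat.le_add_right _ _)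
  have hlen : y.2.1.length + 1 ≤ sz y + B := by
    have := length_le_sz y.2.1
    simp only [sz_prod]
    omega
  have hy : sz y ≤ sz y + B := Nat.le_add_right _ _
  set x := sz y + B
  have hm' : m y ≤ x ^ (2 * c) := hm.trans <| by
    rw [pow_mul]
    exact Nat.pow_le_pow_left (by nlinarith) c
  have h1 : x ≤ x ^ (2 * c + 1) := Nat.le_self_pow (by omega) x
  have h2 : 2 ^ 7 * x ^ (2 * c + 1) ≤ x ^ (2 * c + 8) := by
    rw [show 2 * c + 8 = 7 + (2 * c + 1) by ring, pow_add x 7]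
    exact Nat.mul_le_mul_right _ (Nat.pow_le_pow_left hx 7)
  have h3 : (y.2.1.length + 1) * (m y + 30 + 14) ≤ x * (x ^ (2 * c) + 44) :=
    Nat.mul_le_mul hlen (by omega)
  have h4 : x * (x ^ (2 * c) + 44) = x ^ (2 * c + 1) + 44 * x := by ring
  simp only [List.length_cons]
  omega

end

/-! ### Instances -/

section Digits

/-- The first `m` entries of a list of binary digits, extended by zeros if necessary. -/
def takeDigits : ℕ → List Bool → List Bool
  | 0, _ => []
  | m + 1, bits => bits.headD false :: takeDigits m bits.tail

lemma foldl_readStep {γ : Type} (l : List γ) (bits rev : List Bool) :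
    l.foldl (fun s _ => readStep s) (bits, rev) =
      (bits.drop l.length, (takeDigits l.length bits).reverse ++ rev) := by
  induction l generalizing bits rev with
  | nil => rfl
  | cons a l ih =>
    rw [List.foldl_cons, readStep, ih]
    simp [takeDigits]

lemma length_takeDigits (m : ℕ) (bits : List Bool) : (takeDigits m bits).length = m := by
  induction m generalizing bits with
  | zero => rfl
  | succ m ih => simp [takeDigits, ih]

lemma cappedValue_reverse_takeDigits (cap m k : ℕ) (h : k.bits.length ≤ m) :
    cappedValue cap (takeDigits m k.bits).reverse = min cap k := by
  rw [cappedValue, List.foldl_reverse]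
  have h1 (m : ℕ) (l : List Bool) (h : l.length ≤ m) :
      (takeDigits m l).foldr (fun b x => min cap (x + x + if b then 1 else 0)) 0 =
        l.foldr (fun b x => min cap (x + x + if b then 1 else 0)) 0 := by
    induction m generalizing l with
    | zero => rw [List.length_eq_zero_iff.1 (Nat.le_zero.1 h)]; rfl
    | succ m ih =>
      cases l with
      | nil =>
        have := ih [] (Nat.zero_le _)
        simp only [List.foldr_nil] at this
        simp [takeDigits, this]
      | cons a l => simp [takeDigits, ih l (by simpa using h)]
  have h2 : k.bits.foldr (fun b x => min cap (x + x + if b then 1 else 0)) 0 = min cap k := by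
    clear h
    induction k using Nat.binaryRec' with
    | zero => simp
    | bit b n hb ih =>
      rw [Nat.bits_append_bit n b hb, List.foldr_cons, ih, Nat.bit_val]
      cases b <;> simp <;> omega
  exact (h1 m _ h).trans h2

end Digits

section Graphs
variable {n : ℕ} {G : SimpleGraph (Fin n)}

open Classical in
/-- The adjacency matrix of a graph. -/
noncomputable def matrix (r : Fin n → Fin n → Prop) : List (List Bool) :=
  List.ofFn fun i => List.ofFn fun j => decide (r i j)

open Classical in
/-- The characteristic vector of a set of vertices. -/
noncomputable def charVec (s : Set (Fin n)) : List Bool := List.ofFn fun i => decide (i ∈ s)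

lemma enc_charVec (s : Set (Fin n)) : enc (charVec s) = encSet s := by
  simp only [enc, charVec, encSet, List.map_ofFn]
  rfl

lemma enc_matrix (r : Fin n → Fin n → Prop) : enc (matrix r) = encRel r := by
  simp only [encRel, ← enc_charVec]
  change encList (List.map enc _) = _
  rw [matrix, List.map_ofFn]
  rfl

lemma charVec_getD {s : Set (Fin n)} {v : ℕ} :
    (charVec s).getD v false = true ↔ ∃ h : v < n, ⟨v, h⟩ ∈ s := by
  by_cases h : v < n
  · rw [List.getD_eq_getElem _ _ (by simpa [charVec] using h)]
    simp [charVec, h]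
  · rw [List.getD_eq_default _ _ (by simpa [charVec] using h)]
    simp [h]

lemma edge_matrix {r : Fin n → Fin n → Prop} {u v : ℕ} :
    Edge (matrix r) u v ↔ ∃ (hu : u < n) (hv : v < n), r ⟨u, hu⟩ ⟨v, hv⟩ := by
  by_cases h : u < n
  · have : (matrix r).getD u [] = charVec {j | r ⟨u, h⟩ j} := by
      rw [List.getD_eq_getElem _ _ (by simpa [matrix] using h)]
      simp [matrix, charVec]
    rw [Edge, adj, this, charVec_getD]
    simp [h]
  · have : (matrix r).getD u [] = [] :=
      List.getD_eq_default _ _ (by simpa [matrix] using h)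
    rw [Edge, adj, this]
    simp [h]

open Classical in
/-- The vertices of a subgraph. -/
noncomputable def vertexSet (F : G.Subgraph) : Finset ℕ :=
  (Finset.univ.filter fun v => v ∈ F.verts).map Fin.valEmbedding

lemma mem_vertexSet {F : G.Subgraph} {v : Fin n} : (v : ℕ) ∈ vertexSet F ↔ v ∈ F.verts := by
  simp [vertexSet, Fin.val_inj]

lemma exists_of_mem_vertexSet {F : G.Subgraph} {x : ℕ} (hx : x ∈ vertexSet F) :
    ∃ v : Fin n, v ∈ F.verts ∧ (v : ℕ) = x := by
  simpa [vertexSet] using hx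

lemma disjoint_vertexSet {F F' : G.Subgraph} :
    Disjoint (vertexSet F) (vertexSet F') ↔ Disjoint F.verts F'.verts := by
  rw [Finset.disjoint_left, Set.disjoint_left]
  constructor
  · exact fun h v hv hv' => h (mem_vertexSet.2 hv) (mem_vertexSet.2 hv')
  · intro h x hx hx'
    obtain ⟨v, hv, rfl⟩ := exists_of_mem_vertexSet hx
    exact h hv (mem_vertexSet.1 hx')

lemma conn_vertexSet {F : G.Subgraph} (hF : F.coe.Connected) :
    Conn (Edge (matrix G.Adj)) (vertexSet F) := by
  constructor
  · obtain ⟨v⟩ := hF.nonempty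
    exact ⟨_, mem_vertexSet.2 v.2⟩
  · intro T hT ⟨x, hx⟩ hcl
    refine hT.antisymm fun y hy => ?_
    obtain ⟨u, hu, rfl⟩ := exists_of_mem_vertexSet (hT hx)
    obtain ⟨v, hv, rfl⟩ := exists_of_mem_vertexSet hy
    obtain ⟨p⟩ := hF.preconnected ⟨u, hu⟩ ⟨v, hv⟩
    have key : ∀ {a b : F.verts} (p : F.coe.Walk a b), ((a : Fin n) : ℕ) ∈ T →
        ((b : Fin n) : ℕ) ∈ T := by
      intro a b p
      induction p with
      | nil => exact id
      | cons h _ ih =>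
        exact fun ha => ih (hcl _ ha _ (mem_vertexSet.2 (Subtype.property _))
          (edge_matrix.2 ⟨_, _, F.adj_sub h⟩))
    exact key p hx

end Graphs

section Instances
variable {𝓗 : Set FinGraph} (I : Instance 𝓗)

/-- The data of an instance. -/
noncomputable def Instance.raw : RawInput :=
  (matrix I.G.Adj, I.L.map fun F => (charVec F.verts, matrix F.Adj), I.k.bits)

lemma Instance.enc_raw : enc I.raw = I.encode := by
  have h : enc (I.L.map fun F => (charVec F.verts, matrix F.Adj)) =
      encList (I.L.map encSubgraph) := by
    change encList (List.map enc _) = _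
    rw [List.map_map]
    congr 2
    funext F
    simp [encSubgraph, enc_charVec, enc_matrix]
  simp only [raw, enc_prod, h, enc_matrix, encode]
  rfl

/-- The data that `search` receives for an instance. -/
noncomputable def Instance.searchInput : SearchInput := prepare (readBits I.raw)

/-- The vertices of the members of the list. -/
noncomputable abbrev Instance.members : List (List ℕ) := I.searchInput.2.2.1

lemma Instance.searchInput_matrix : I.searchInput.1 = matrix I.G.Adj := rfl

lemma Instance.searchInput_vertices : I.searchInput.2.1 = (List.range I.n).reverse := by
  change indices (matrix I.G.Adj) = _
  rw [indices_eq]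
  simp [matrix]

lemma Instance.length_members : I.members.length = I.L.length := by
  simp [members, searchInput, prepare, readBits, raw]

lemma Instance.family_members : family I.members = (I.L.map vertexSet).toFinset := by
  have : I.members = I.L.map fun F => I.searchInput.2.1.filter fun v =>
      (charVec F.verts).getD v false := by
    simp [members, searchInput, prepare, readBits, raw]
  rw [family, this, List.map_map]
  congr 2
  funext F
  ext x
  simp only [Function.comp_apply, List.mem_toFinset, List.mem_filter, I.searchInput_vertices,
    List.mem_reverse, List.mem_range, charVec_getD]
  constructor
  · rintro ⟨-, h, hx⟩
    exact mem_vertexSet.2 hx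
  · intro h
    obtain ⟨v, hv, rfl⟩ := exists_of_mem_vertexSet h
    exact ⟨v.2, v.2, hv⟩

lemma Instance.edge_symm (x y : ℕ) (h : Edge I.searchInput.1 x y) : Edge I.searchInput.1 y x := by
  obtain ⟨hx, hy, h⟩ := edge_matrix.1 h
  exact edge_matrix.2 ⟨hy, hx, h.symm⟩

variable {I}

lemma Instance.conn_of_mem_L (h𝓗 : ∀ H ∈ 𝓗, H.2.Connected) {F : I.G.Subgraph} (hF : F ∈ I.L) :
    F.coe.Connected := by
  obtain ⟨H, hH, ⟨e⟩⟩ := I.iso_mem F hF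
  exact e.connected_iff.2 (h𝓗 H hH)

lemma Instance.conn_of_mem (h𝓗 : ∀ H ∈ 𝓗, H.2.Connected) {F : Finset ℕ}
    (hF : F ∈ family I.members) : Conn (Edge I.searchInput.1) F := by
  rw [I.family_members] at hF
  obtain ⟨F', hF', rfl⟩ := List.mem_map.1 (List.mem_toFinset.1 hF)
  exact conn_vertexSet (conn_of_mem_L h𝓗 hF')

/-- Members are nonempty, so disjoint subgraphs have distinct vertex sets, and packings of
subgraphs correspond to packings of vertex sets. -/
lemma Instance.isYes_iff (h𝓗 : ∀ H ∈ 𝓗, H.2.Connected) {j : ℕ}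
    (hj : IsOpt (family I.members) (Finset.range I.n) j) : I.IsYes ↔ I.k ≤ j := by
  classical
  have hne : ∀ F ∈ I.L, (vertexSet F).Nonempty := fun F hF =>
    (conn_vertexSet (conn_of_mem_L h𝓗 hF)).1
  have hmem : ∀ F, F ∈ family I.members ↔ ∃ F' ∈ I.L, vertexSet F' = F := fun F => by
    rw [I.family_members]; simp
  constructor
  · rintro ⟨S, hSL, hk, hS⟩
    refine hk.trans (hj.2 ⟨S.image vertexSet, ⟨fun F hF => ?_, fun F hF x hx => ?_,
      fun F hF F' hF' h => ?_⟩, Finset.card_image_of_injOn fun F hF F' hF' h => ?_⟩)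
    · obtain ⟨F', hF', rfl⟩ := Finset.mem_image.1 hF
      exact (hmem _).2 ⟨F', hSL F' hF', rfl⟩
    · obtain ⟨F, hF, rfl⟩ := Finset.mem_image.1 hF
      obtain ⟨v, -, rfl⟩ := exists_of_mem_vertexSet hx
      simp
    · obtain ⟨F₁, h₁, rfl⟩ := Finset.mem_image.1 hF
      obtain ⟨F₂, h₂, rfl⟩ := Finset.mem_image.1 hF'
      exact disjoint_vertexSet.2 (hS h₁ h₂ fun e => h (e ▸ rfl))
    · by_contra hFF'
      have := disjoint_vertexSet.2 (hS hF hF' hFF')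
      rw [← h, disjoint_self] at this
      exact (hne F (hSL F hF)).ne_empty this
  · intro hk
    obtain ⟨⟨P, hP, hPj⟩, -⟩ := hj
    have hf : ∀ F : Finset ℕ, ∃ F' : I.G.Subgraph, F ∈ P → F' ∈ I.L ∧ vertexSet F' = F := by
      intro F
      by_cases hF : F ∈ P
      · obtain ⟨F', h⟩ := (hmem F).1 (hP.mem F hF)
        exact ⟨F', fun _ => h⟩
      · exact ⟨⊥, fun h => (hF h).elim⟩
    choose f hf using hf
    refine ⟨P.image f, fun F hF => ?_, ?_, fun F hF F' hF' h => ?_⟩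
    · obtain ⟨F', hF', rfl⟩ := Finset.mem_image.1 hF
      exact (hf F' hF').1
    · rw [Finset.card_image_of_injOn fun F hF F' hF' h => ?_, hPj]
      · exact hk
      · rw [← (hf F hF).2, ← (hf F' hF').2, h]
    · obtain ⟨F₁, h₁, rfl⟩ := Finset.mem_image.1 (Finset.mem_coe.1 hF)
      obtain ⟨F₂, h₂, rfl⟩ := Finset.mem_image.1 (Finset.mem_coe.1 hF')
      rw [← disjoint_vertexSet, (hf F₁ h₁).2, (hf F₂ h₂).2]
      exact hP.disjoint F₁ h₁ F₂ h₂ fun e => h (e ▸ rfl)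

/-- The comparison with `k` is correct, although only the first digits are read. -/
lemma Instance.le_iff {j : ℕ} (hj : j ≤ I.L.length) :
    (I.searchInput.2.2.2.2 && decide (I.searchInput.2.2.2.1 ≤ j)) = true ↔ I.k ≤ j := by
  have hlen : (([], []) :: I.raw.2.1 : List (List Bool × List (List Bool))).length =
      I.L.length + 1 := by simp [raw]
  have hloop : readLoop I.raw = (I.k.bits.drop (I.L.length + 1),
      (takeDigits (I.L.length + 1) I.k.bits).reverse) := by
    rw [readLoop, foldl_readStep, hlen, List.append_nil]
    rfl
  have h1 : I.searchInput.2.2.2.2 = (I.k.bits.drop (I.L.length + 1)).isEmpty := by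
    change (readLoop I.raw).1.isEmpty = _
    rw [hloop]
  have h2 : I.searchInput.2.2.2.1 = cappedValue (I.L.length + 1)
      (takeDigits (I.L.length + 1) I.k.bits).reverse := by
    change cappedValue ((I.L.map _).length + 1) (readLoop I.raw).2 = _
    rw [hloop, List.length_map]
  rw [h1, h2, Bool.and_eq_true, decide_eq_true_eq, List.isEmpty_iff, List.drop_eq_nil_iff]
  constructor
  · rintro ⟨h, h'⟩
    rw [cappedValue_reverse_takeDigits _ _ _ h] at h'
    omega
  · intro h
    have hb : I.k.bits.length ≤ I.L.length + 1 := by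
      rw [Nat.size_eq_bits_len, Nat.size_le]
      exact (h.trans hj).trans_lt ((Nat.lt_succ_self _).trans Nat.lt_two_pow_self)
    refine ⟨hb, ?_⟩
    rw [cappedValue_reverse_takeDigits _ _ _ hb]
    omega

end Instances

/-! ### Correctness and running time of the search -/

section Search

lemma searchLoop_concat (y : SearchInput) (l : List ℕ) (x : ℕ) :
    searchLoop y (l ++ [x]) = searchStep y (searchLoop y l) := by
  simp [searchLoop]

lemma sz_extend_le (M : List (List ℕ)) (𝒬 : List (List (List ℕ))) :
    sz (extend M 𝒬) ≤ 3 * sz M * sz 𝒬 := by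
  have h1 (q : List ℕ) (𝒬' : List (List (List ℕ))) (h : 𝒬'.Sublist 𝒬) :
      sz (𝒬'.map fun Q => q :: Q) ≤ 2 * sz 𝒬 * sz q := by
    have h2 : ∀ 𝒬' : List (List (List ℕ)),
        sz (𝒬'.map fun Q => q :: Q) = 𝒬'.length * sz q + sz 𝒬' := fun 𝒬' => by
      induction 𝒬' with
      | nil => simp
      | cons a l ih => simp only [List.map_cons, sz_cons, ih, List.length_cons]; ring
    have h3 := sz_le_of_sublist h
    have h4 := length_le_sz 𝒬'
    have h5 := two_le_sz q
    rw [h2]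
    nlinarith
  have h2 : sz (M.flatMap fun q => (𝒬.filter fun Q => Q.all fun q' => !meets q q').map
      fun Q => q :: Q) ≤ 2 * sz 𝒬 * sz M := by
    have key (f : List ℕ → List (List (List ℕ))) (hf : ∀ q, sz (f q) ≤ 2 * sz 𝒬 * sz q) :
        sz (M.flatMap f) ≤ 2 * sz 𝒬 * sz M := by
      induction M with
      | nil =>
        have := two_le_sz 𝒬
        simp only [List.flatMap_nil, sz_nil]
        omega
      | cons q M ih =>
        have h3 := sz_append (f q) (M.flatMap f)
        have h4 := hf q
        rw [List.flatMap_cons, sz_cons, Nat.mul_add]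
        omega
    exact key _ fun q => h1 q _ List.filter_sublist
  have h3 := two_le_sz 𝒬
  have h4 := two_le_sz M
  rw [extend, sz_cons, sz_nil]
  nlinarith

variable {𝓗 : Set FinGraph} {I : Instance 𝓗}

/-- The one-element sets of vertices. -/
noncomputable abbrev Instance.singletons (I : Instance 𝓗) : List (List ℕ) :=
  I.searchInput.2.1.map fun v => [v]

lemma Instance.toFinset_vertices (I : Instance 𝓗) :
    I.searchInput.2.1.toFinset = Finset.range I.n := by
  rw [I.searchInput_vertices]
  ext; simp

/-- The state after the steps in `l`: the answer, if known, is correct, and otherwise the number of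
steps is at most the treewidth. -/
lemma Instance.searchLoop_spec (h𝓗 : ∀ H ∈ 𝓗, H.2.Connected) (l : List ℕ) :
    ((searchLoop I.searchInput l).1 = true →
      ((searchLoop I.searchInput l).2.1 = true ↔ I.IsYes)) ∧
    ((searchLoop I.searchInput l).1 = false → l.length ≤ treewidth I.G ∧
      (IsFamilies I.singletons l.length (searchLoop I.searchInput l).2.2.1 ∧
        sz (searchLoop I.searchInput l).2.2.1 ≤ (3 * sz I.singletons) ^ l.length * 4) ∧
      (IsFamilies I.members l.length (searchLoop I.searchInput l).2.2.2 ∧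
        sz (searchLoop I.searchInput l).2.2.2 ≤ (3 * sz I.members) ^ l.length * 4)) := by
  induction l using List.reverseRecOn with
  | nil =>
    refine ⟨fun h => by simp [searchLoop] at h, fun _ => ⟨Nat.zero_le _, ⟨isFamilies_zero _, ?_⟩,
      isFamilies_zero _, ?_⟩⟩ <;> simp [searchLoop]
  | append_singleton l x ih =>
    rw [searchLoop_concat, List.length_append, List.length_singleton]
    set s := searchLoop I.searchInput l
    cases hs : s.1 with
    | true =>
      have : searchStep I.searchInput s = s := by simp [searchStep, hs]
      rw [this]
      exact ⟨ih.1, fun h => by simp [hs] at h⟩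
    | false =>
      have : searchStep I.searchInput s = widen I.searchInput s := by simp [searchStep, hs]
      rw [this]
      obtain ⟨hl, ⟨h𝒰, sz𝒰⟩, h𝒬, sz𝒬⟩ := ih.2 hs
      have hconn : ∀ F ∈ family I.members, Conn (Edge I.searchInput.1) F := fun F =>
        conn_of_mem h𝓗
      have h𝒰' := h𝒰.extend
      have h𝒬' := h𝒬.extend
      refine ⟨fun h => ?_, fun h => ⟨?_, ⟨h𝒰', ?_⟩, h𝒬', ?_⟩⟩
      · have hopt := isOpt_solve I.edge_symm hconn le_rfl h𝒬' h𝒰'.isSeparators.card_le h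
        rw [I.toFinset_vertices] at hopt
        have hle := hopt.le_card.trans ((List.toFinset_card_le _).trans (List.length_map _).le)
        rw [isYes_iff h𝓗 hopt]
        exact le_iff (hle.trans_eq I.length_members)
      · by_contra hlt
        obtain ⟨D, hD⟩ := exists_treeDecomposition I.G
        have hsep := D.isSeparatorSystem (E := Edge I.searchInput.1) fun u v => by
          rw [I.searchInput_matrix, edge_matrix]; simp
        have hk : D.width + 1 = l.length + 1 := by omega
        rw [hk, ← I.toFinset_vertices] at hsep
        have := solve_of_isSeparatorSystem (cap := I.members.length) I.edge_symm hconn h𝒬'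
          h𝒰'.isSeparators hsep
        exact absurd (h.symm.trans this) (by simp)
      · exact (sz_extend_le _ _).trans ((Nat.mul_le_mul_left _ sz𝒰).trans_eq (by ring))
      · exact (sz_extend_le _ _).trans ((Nat.mul_le_mul_left _ sz𝒬).trans_eq (by ring))

lemma Instance.search_iff (h𝓗 : ∀ H ∈ 𝓗, H.2.Connected) :
    search I.searchInput = true ↔ I.IsYes := by
  obtain ⟨h1, h2⟩ := searchLoop_spec (I := I) h𝓗 (0 :: I.searchInput.2.1)
  refine h1 ?_
  by_contra h
  have h3 := (h2 (by simpa using h)).1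
  have h4 := treewidth_le I.G
  rw [I.searchInput_vertices] at h3
  simp at h3
  omega

end Search

section Time

/-- All instances for classes of connected graphs. -/
abbrev ConnInstance : Type := {I : Σ 𝓗 : Set FinGraph, Instance 𝓗 // ∀ H ∈ I.1, H.2.Connected}

/-- The number of vertices plus the number of subgraphs, but at least `2`. -/
def inputSize (I : ConnInstance) : ℕ := max (I.1.2.n + I.1.2.L.length) 2

/-- The bound whose powers bound the running time. -/
noncomputable def timeScale (I : ConnInstance) : ℕ := inputSize I ^ max (treewidth I.1.2.G) 1

lemma two_le_inputSize (I : ConnInstance) : 2 ≤ inputSize I := le_max_right _ _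

lemma inputSize_le_timeScale (I : ConnInstance) : inputSize I ≤ timeScale I :=
  Nat.le_self_pow (by omega) _

lemma two_le_timeScale (I : ConnInstance) : 2 ≤ timeScale I :=
  (two_le_inputSize I).trans (inputSize_le_timeScale I)

lemma sz_charVec_le {n : ℕ} (s : Set (Fin n)) : sz (charVec s) ≤ n * 4 + 2 :=
  (sz_le_of_forall fun b _ => sz_bool_le b).trans (by simp [charVec])

lemma sz_matrix_le {n : ℕ} (r : Fin n → Fin n → Prop) : sz (matrix r) ≤ n * (n * 4 + 2) + 2 := by
  refine (sz_le_of_forall (B := n * 4 + 2) fun l hl => ?_).trans (by simp [matrix])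
  obtain ⟨i, rfl⟩ := (List.mem_ofFn' _ _).1 hl
  exact sz_charVec_le {j | r i j}

lemma polyBdd_sz_readBits : PolyBdd inputSize fun I => sz (readBits I.1.2.raw) := by
  have hN := two_le_inputSize
  have hn : PolyBdd inputSize fun I => I.1.2.n :=
    PolyBdd.self.mono fun I => (Nat.le_add_right _ _).trans (le_max_left _ _)
  have hL : PolyBdd inputSize fun I => I.1.2.L.length :=
    PolyBdd.self.mono fun I => (Nat.le_add_left _ _).trans (le_max_left _ _)
  have hrow : PolyBdd inputSize fun I => I.1.2.n * 4 + 2 :=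
    (hn.mul (.const hN 4)).add hN (.const hN 2)
  have hmat : PolyBdd inputSize fun I => I.1.2.n * (I.1.2.n * 4 + 2) + 2 :=
    (hn.mul hrow).add hN (.const hN 2)
  have hlist := (hL.mul (hrow.add hN hmat)).add hN (.const hN 2)
  have hbits := ((hL.add hN (.const hN 1)).mul (.const hN 4)).add hN (.const hN 2)
  refine ((hmat.add hN hlist).add hN (hbits.add hN (.const hN 4))).mono fun I => ?_
  simp only [readBits, sz_prod]
  refine Nat.add_le_add (Nat.add_le_add (sz_matrix_le _) ?_) (Nat.add_le_add ?_ (sz_bool_le _))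
  · refine (sz_le_of_forall (B := I.1.2.n * 4 + 2 + (I.1.2.n * (I.1.2.n * 4 + 2) + 2))
      fun F hF => ?_).trans (by simp [Instance.raw])
    obtain ⟨F, -, rfl⟩ := List.mem_map.1 hF
    exact Nat.add_le_add (sz_charVec_le _) (sz_matrix_le _)
  · refine (sz_le_of_forall fun b _ => sz_bool_le b).trans ?_
    rw [readLoop, foldl_readStep]
    simp [length_takeDigits, Instance.raw]

/-- A single program decides all instances in time polynomial in `timeScale`. -/
theorem exists_computesIn : ∃ (f : RawInput → Bool) (T : RawInput → ℕ), ComputesIn f T ∧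
    (∀ I : ConnInstance, f I.1.2.raw = true ↔ I.1.2.IsYes) ∧
    PolyBdd timeScale fun I => T I.1.2.raw := by
  obtain ⟨C, hread⟩ := computesIn_readBits
  obtain ⟨⟨Tp, hTp, bTp⟩, bprep⟩ := polyTime_prepare
  obtain ⟨c, Ts, hTs, bTs⟩ := computesIn_search
  refine ⟨_, _, hTs.comp (hTp.comp hread), fun I => Instance.search_iff I.2, ?_⟩
  have hN := two_le_timeScale
  have hscale : PolyBdd timeScale inputSize := PolyBdd.self.mono inputSize_le_timeScale
  have hL : PolyBdd timeScale fun I => I.1.2.L.length :=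
    hscale.mono fun I => (Nat.le_add_left _ _).trans (le_max_left _ _)
  have hy' : PolyBdd inputSize fun I => sz I.1.2.searchInput :=
    (bprep.comp_right fun I : ConnInstance => readBits I.1.2.raw).trans polyBdd_sz_readBits
  -- lists of at most `treewidth` sets, taken from a list of polynomial size
  have hpow (f : ConnInstance → ℕ) (hf : PolyBdd inputSize f) :
      PolyBdd timeScale fun I => (3 * f I) ^ treewidth I.1.2.G * 4 := by
    refine PolyBdd.mul ?_ (.const hN 4)
    obtain ⟨k, hk⟩ := (PolyBdd.const two_le_inputSize 3).mul hf
    refine ⟨k, fun I => (Nat.pow_le_pow_left (hk I) _).trans ?_⟩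
    rw [timeScale, ← pow_mul, ← pow_mul, mul_comm]
    exact Nat.pow_le_pow_right (by have := two_le_inputSize I; omega)
      (Nat.mul_le_mul_right _ (le_max_left _ _))
  have hsing : PolyBdd inputSize fun I : ConnInstance => sz I.1.2.singletons :=
    ((show PolyTime fun y : SearchInput => y.2.1.map fun v => [v] by fun_prop).2.comp_right
      fun I : ConnInstance => I.1.2.searchInput).trans hy'
  have hmem : PolyBdd inputSize fun I : ConnInstance => sz I.1.2.members :=
    ((show PolyTime fun y : SearchInput => y.2.2.1 by fun_prop).2.comp_right
      fun I : ConnInstance => I.1.2.searchInput).trans hy'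
  have hB := (PolyBdd.const hN 8).add hN ((hpow _ hsing).add hN (hpow _ hmem))
  have hsearch := (((hy'.trans hscale).add hN hB).pow c).mono fun I : ConnInstance =>
    bTs I.1.2.searchInput _ fun l _ hl => by
      obtain ⟨h1, ⟨-, h2⟩, -, h3⟩ := (Instance.searchLoop_spec I.2 l).2 hl
      have h4 := sz_bool_le (searchLoop I.1.2.searchInput l).1
      have h5 := sz_bool_le (searchLoop I.1.2.searchInput l).2.1
      have h6 := two_le_sz I.1.2.singletons
      have h7 := two_le_sz I.1.2.members
      have h8 := Nat.pow_le_pow_right (n := 3 * sz I.1.2.singletons) (by omega) h1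
      have h9 := Nat.pow_le_pow_right (n := 3 * sz I.1.2.members) (by omega) h1
      simp only [sz_prod]
      omega
  have hreadT := (PolyBdd.const hN C).mul (hL.add hN (.const hN 1))
  have hprepT := ((bTp.comp_right fun I : ConnInstance => readBits I.1.2.raw).trans
    polyBdd_sz_readBits).trans hscale
  refine ((hreadT.add hN hprepT).add hN hsearch).mono fun I => ?_
  simp only [Instance.raw, List.length_map]
  exact le_rfl

/-- A program that computes the answers solves the decision problem. -/
lemma ComputesIn.solvableInTime {α β : Type} [Code β] {e : α → Dat} {yes : α → Prop} {bound : α → ℕ}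
    {f : β → Bool} {T : β → ℕ} (hf : ComputesIn f T) (g : α → β) (he : ∀ a, enc (g a) = e a)
    (hyes : ∀ a, f (g a) = true ↔ yes a) (hT : ∀ a, T (g a) ≤ bound a) :
    SolvableInTime e yes bound := by
  obtain ⟨p, hp⟩ := hf
  refine ⟨p 0, fun a => ?_⟩
  obtain ⟨t, σ, h1, h2, h3, -⟩ := hp 0 (initStore (e a)) (g a) (by simp [initStore, he])
  refine ⟨t, σ, h1, h2.trans (hT a), fun h => ?_, fun h => ?_⟩
  · rw [h3, (hyes a).2 h]; rfl
  · rw [h3, Bool.eq_false_iff.2 fun h' => h ((hyes a).1 h')]; rfl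

lemma exists_solvableInTime : ∃ c : ℕ, ∀ 𝓗 : Set FinGraph, (∀ H ∈ 𝓗, H.2.Connected) →
    SolvableInTime (fun I : Instance 𝓗 => I.encode) (fun I => I.IsYes)
      (fun I => max (I.n + I.L.length) 2 ^ (c * max (treewidth I.G) 1)) := by
  obtain ⟨f, T, hf, hyes, c, hc⟩ := exists_computesIn
  refine ⟨c, fun 𝓗 h𝓗 => hf.solvableInTime (fun I => I.raw) (fun I => I.enc_raw)
    (fun I => hyes ⟨⟨𝓗, I⟩, h𝓗⟩) fun I => (hc ⟨⟨𝓗, I⟩, h𝓗⟩).trans_eq ?_⟩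
  rw [timeScale, inputSize, ← pow_mul, mul_comm]

end Time

/-! ### Finite classes of graphs -/

/-- If `𝓗` is finite, then the number of subgraphs is polynomial in the number of vertices: each is
the image of a graph in `𝓗` under a map of vertices. -/
lemma exists_length_le {𝓗 : Set FinGraph} (h : 𝓗.Finite) :
    ∃ c, ∀ I : Instance 𝓗, I.L.length ≤ max I.n 2 ^ c := by
  classical
  refine ⟨h.toFinset.card + ∑ H ∈ h.toFinset, H.1, fun I => ?_⟩
  have hz : ∀ F : I.G.Subgraph, ∃ z : Σ H : FinGraph, (Fin H.1 → Fin I.n), F ∈ I.L → z.1 ∈ 𝓗 ∧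
      (∀ u, u ∈ F.verts ↔ ∃ a, z.2 a = u) ∧
      ∀ u v, F.Adj u v ↔ ∃ a b, z.2 a = u ∧ z.2 b = v ∧ z.1.2.Adj a b := by
    intro F
    by_cases hF : F ∈ I.L
    · obtain ⟨H, hH, ⟨e⟩⟩ := I.iso_mem F hF
      refine ⟨⟨H, fun a => (e.symm a : F.verts)⟩, fun _ => ⟨hH, fun u => ⟨fun hu => ?_, ?_⟩,
        fun u v => ⟨fun huv => ?_, ?_⟩⟩⟩
      · exact ⟨e ⟨u, hu⟩, by simp⟩
      · rintro ⟨a, rfl⟩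
        exact (e.symm a).2
      · refine ⟨e ⟨u, F.edge_vert huv⟩, e ⟨v, F.edge_vert huv.symm⟩, by simp, by simp, ?_⟩
        rw [e.map_adj_iff]
        exact huv
      · rintro ⟨a, b, rfl, rfl, hab⟩
        exact e.symm.map_adj_iff.2 hab
    · exact ⟨⟨⟨0, ⊥⟩, Fin.elim0⟩, fun h => (hF h).elim⟩
  choose f hf using hz
  have hcard : I.L.toFinset.card ≤
      (h.toFinset.sigma fun H => (Finset.univ : Finset (Fin H.1 → Fin I.n))).card := by
    refine Finset.card_le_card_of_injOn f (fun F hF => ?_) fun F hF F' hF' he => ?_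
    · have := (hf F (List.mem_toFinset.1 hF)).1
      simpa using this
    · obtain ⟨-, h1, h2⟩ := hf F (List.mem_toFinset.1 hF)
      obtain ⟨-, h1', h2'⟩ := hf F' (List.mem_toFinset.1 hF')
      rw [he] at h1 h2
      refine SimpleGraph.Subgraph.ext (Set.ext fun u => (h1 u).trans (h1' u).symm) ?_
      funext u v
      exact propext ((h2 u v).trans (h2' u v).symm)
  rw [List.toFinset_card_of_nodup I.nodup, Finset.card_sigma] at hcard
  have hX : 1 ≤ max I.n 2 := by omega
  refine hcard.trans ((Finset.sum_le_card_nsmul _ _ (max I.n 2 ^ ∑ H ∈ h.toFinset, H.1)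
    fun H hH => ?_).trans ?_)
  · rw [Finset.card_univ, Fintype.card_fun, Fintype.card_fin, Fintype.card_fin]
    exact (Nat.pow_le_pow_left (le_max_left _ _) _).trans (Nat.pow_le_pow_right hX
      (Finset.single_le_sum (f := fun H : FinGraph => H.1) (fun _ _ => Nat.zero_le _) hH))
  · rw [smul_eq_mul, pow_add]
    exact Nat.mul_le_mul_right _ (Nat.lt_two_pow_self.le.trans
      (Nat.pow_le_pow_left (le_max_right _ _) _))

end ListPacking

theorem mainTheorem4 :
    (∃ c : ℕ, ∀ 𝓗 : Set ListPacking.FinGraph, (∀ H ∈ 𝓗, H.2.Connected) →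
      ListPacking.SolvableInTime
        (fun I : ListPacking.Instance 𝓗 => I.encode) (fun I => I.IsYes)
        (fun I => max (I.n + I.L.length) 2 ^ (c * max (ListPacking.treewidth I.G) 1))) ∧
    (∀ 𝓗 : Set ListPacking.FinGraph, (∀ H ∈ 𝓗, H.2.Connected) → 𝓗.Finite →
      ∃ c : ℕ, ListPacking.SolvableInTime
        (fun I : ListPacking.Instance 𝓗 => I.encode) (fun I => I.IsYes)
        (fun I => max I.n 2 ^ (c * max (ListPacking.treewidth I.G) 1))) := by
  obtain ⟨c, hc⟩ := ListPacking.exists_solvableInTime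
  refine ⟨⟨c, hc⟩, fun 𝓗 h𝓗 hfin => ?_⟩
  obtain ⟨k, hk⟩ := ListPacking.exists_length_le hfin
  obtain ⟨p, hp⟩ := hc 𝓗 h𝓗
  refine ⟨(k + 2) * c, p, fun I => ?_⟩
  obtain ⟨t, σ, h1, h2, h3⟩ := hp I
  refine ⟨t, σ, h1, h2.trans ?_, h3⟩
  beta_reduce
  rw [mul_assoc, pow_mul (max I.n 2)]
  refine Nat.pow_le_pow_left ?_ _
  have hX : 2 ≤ max I.n 2 := le_max_right _ _
  have hn : I.n ≤ max I.n 2 := le_max_left _ _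
  have hL := hk I
  set X := max I.n 2
  have h4 : 1 ≤ X ^ k := Nat.one_le_pow _ _ (by omega)
  have h5 : X ^ (k + 2) = X ^ k * X * X := by ring
  have h6 : X ≤ X ^ k * X := Nat.le_mul_of_pos_left _ h4
  have h7 : X ^ k ≤ X ^ k * X := Nat.le_mul_of_pos_right _ (by omega)
  have h8 : X ^ k * X * 2 ≤ X ^ k * X * X := Nat.mul_le_mul_left _ hX
  omega
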